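/- Let $\mathcal M$ be the set of finite positive Borel measures on $\mathbb R$ with finite first moment. For $\eta,\chi\in\mathcal M$ write $\eta\le\chi$ if $\eta(A)\le\chi(A)$ for all Borel $A\subseteq\mathbb R$; write $\eta\le_{cd}\chi$ if $\int f\,d\eta\le\int f\,d\chi$ for all convex non-increasing $f:\mathbb R\to\mathbb R$; and write $\eta\le_{pcd}\chi$ if $\int f\,d\eta\le\int f\,d\chi$ for all non-negative, convex, non-increasing $f:\mathbb R\to\mathbb R$ (the integrals may take the value $+\infty$). If $\eta\le_{pcd}\chi$, the supermartingale shadow $S^\chi(\eta)$ of $\eta$ in $\chi$ is the least element, with respect to $\le_{cd}$, of $\{\theta\in\mathcal M:\eta\le_{cd}\theta\le\chi\}$. For $\eta,\chi\in\mathcal M$ with $\eta(\mathbb R)=\chi(\mathbb R)$ let $W(\eta,\chi)=\sup_f\left|\int f\,d\eta-\int f\,d\chi\right|$, the supremum being over all $1$-Lipschitz functions $f:\mathbb R\to\mathbb R$ (the Wasserstein-1 distance). **Theorem (stability of the supermartingale shadow).** Let $\mu,\mu',\nu,\nu'\in\mathcal M$ with $\mu(\mathbb R)=\mu'(\mathbb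 R)$ and $\nu(\mathbb R)=\nu'(\mathbb R)$, and suppose that $\mu\le_{pcd}\nu$ and $\mu'\le_{pcd}\nu'$. Then the shadows $S^\nu(\mu)$ and $S^{\nu'}(\mu')$ exist and are unique, and $$W\bigl(S^\nu(\mu),S^{\nu'}(\mu')\bigr)\le W(\mu,\mu')+2\,W(\nu,\nu').$$ -/

import Mathlib

open MeasureTheory

noncomputable section

namespace SupermartingaleShadow

/-- The class of (positive, finite) Borel measures on `ℝ` with finite first moment. -/
def FiniteFirstMoment (η : Measure ℝ) : Prop :=
  IsFiniteMeasure η ∧ Integrable (fun x : ℝ => x) η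

/-- The convex-decreasing order: `∫ f dη ≤ ∫ f dχ` for all convex non-increasing `f : ℝ → ℝ`.
A convex function is bounded below by an affine one, so for measures with finite first moment both
integrals exist in `(-∞, +∞]`, with value `+∞` exactly when `f` is not integrable. The inequality
in `(-∞, +∞]` is therefore the implication below. -/
def ConvexDecreasingLE (η χ : Measure ℝ) : Prop :=
  ∀ f : ℝ → ℝ, ConvexOn ℝ Set.univ f → Antitone f →
    Integrable f χ → Integrable f η ∧ ∫ x, f x ∂η ≤ ∫ x, f x ∂χ

/-- The positive convex-decreasing order: `∫ f dη ≤ ∫ f dχ` (in `[0, +∞]`) for all non-negative,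
convex and non-increasing `f : ℝ → ℝ`. -/
def PosConvexDecreasingLE (η χ : Measure ℝ) : Prop :=
  ∀ f : ℝ → ℝ, (∀ x, 0 ≤ f x) → ConvexOn ℝ Set.univ f → Antitone f →
    ∫⁻ x, ENNReal.ofReal (f x) ∂η ≤ ∫⁻ x, ENNReal.ofReal (f x) ∂χ

/-- The set of all measures `θ` with finite first moment such that `η ≤_cd θ ≤ χ`, where the second
relation is the setwise order of measures: the targets of supermartingales which embed `η`
into `χ`. -/
def targets (η χ : Measure ℝ) : Set (Measure ℝ) :=
  {θ | FiniteFirstMoment θ ∧ ConvexDecreasingLE η θ ∧ θ ≤ χ}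

/-- `σ` is a supermartingale shadow of `η` in `χ`: a least element, for the convex-decreasing
order, of `targets η χ`. -/
def IsShadow (η χ σ : Measure ℝ) : Prop :=
  σ ∈ targets η χ ∧ ∀ θ ∈ targets η χ, ConvexDecreasingLE σ θ

open Classical in
/-- The supermartingale shadow `S^χ(η)` of `η` in `χ` (the zero measure if there is none). -/
def shadow (χ η : Measure ℝ) : Measure ℝ :=
  if h : ∃ σ, IsShadow η χ σ then h.choose else 0

/-- The Wasserstein-1 distance `sup {|∫ f dη - ∫ f dχ| : f 1-Lipschitz}`, with values in
`[0, +∞]`. -/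
def wasserstein (η χ : Measure ℝ) : ENNReal :=
  ⨆ f : {f : ℝ → ℝ // LipschitzWith 1 f}, ENNReal.ofReal |∫ x, f.1 x ∂η - ∫ x, f.1 x ∂χ|

end SupermartingaleShadow

end

/-!
For a finite measure `η` on the line with finite first moment let `P_η k = ∫ (k - x)⁺ dη(x)` be its
put potential, a convex function whose right derivative is the distribution function `F_η`. Convex
non-increasing functions are mixtures of affine ones and of the functions `(k - x)⁺`, so `η ≤_cd χ`
means that the masses agree and `P_η ≤ P_χ` (`convexDecreasingLE_of_potential_le`).

If `θ` is a target of `μ` in `ν`, then `P_ν - P_θ` is the potential of `ν - θ`, hence a convex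
function below the excess `P_ν - P_μ`. Consequently the shadow `σ` has to satisfy
`P_ν - P_σ = D`, where `D` is the greatest convex minorant of `P_ν - P_μ`. That such a measure exists
amounts to the convexity of `P_ν - D` (`convexOn_sub_convexMinorant`), which makes `ν` split as
`ρ + σ` with `P_ρ = D` (`exists_add_eq_of_convexOn`, `exists_isShadow`). Uniqueness holds because
potentials determine measures.

For stability, the Wasserstein distance of measures of equal mass is the `L¹` distance of their
distribution functions (`wasserstein_eq`). As `F_σ = F_ν - F_ρ`, it suffices to show that passing to
greatest convex minorants does not increase the `L¹` distance of the derivatives: then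
`‖F_ρ - F_ρ'‖₁ ≤ ‖(F_ν - F_μ) - (F_ν' - F_μ')‖₁`, and the distance of `ν` and `ν'` enters twice. This
contraction (`intervalIntegral_posPart_rightDeriv_sub_le`) follows, as in the lemma of Crandall and
Tartar, from the fact that the passage preserves the order of the derivatives
(`monotone_convexMinorant_sub`) and does not increase total increments.
-/

namespace SupermartingaleShadow

open Set Filter Topology

/-! ### Greatest convex minorants on the line -/

/-- The greatest convex minorant of `g : ℝ → ℝ`, as the pointwise supremum of all convex minorants.
It is meaningful only if `g` has a convex minorant; otherwise it is the junk value `sSup ∅ = 0`. -/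
noncomputable def convexMinorant (g : ℝ → ℝ) (x : ℝ) : ℝ :=
  sSup {y | ∃ h : ℝ → ℝ, ConvexOn ℝ univ h ∧ (∀ z, h z ≤ g z) ∧ h x = y}

section Minorant

variable {g h : ℝ → ℝ}

theorem le_convexMinorant (hc : ConvexOn ℝ univ h) (hg : ∀ z, h z ≤ g z) (x : ℝ) :
    h x ≤ convexMinorant g x := by
  refine le_csSup ⟨g x, ?_⟩ ⟨h, hc, hg, rfl⟩
  rintro _ ⟨k, -, hk, rfl⟩
  exact hk x

theorem convexMinorant_le (hc : ConvexOn ℝ univ h) (hg : ∀ z, h z ≤ g z) (x : ℝ) :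
    convexMinorant g x ≤ g x := by
  refine csSup_le ⟨_, h, hc, hg, rfl⟩ ?_
  rintro _ ⟨k, -, hk, rfl⟩
  exact hk x

theorem convexOn_convexMinorant (hc : ConvexOn ℝ univ h) (hg : ∀ z, h z ≤ g z) :
    ConvexOn ℝ univ (convexMinorant g) := by
  refine ⟨convex_univ, fun x _ y _ a b ha hb hab => ?_⟩
  refine csSup_le ⟨_, h, hc, hg, rfl⟩ ?_
  rintro _ ⟨k, hk, hkg, rfl⟩
  refine (hk.2 (mem_univ x) (mem_univ y) ha hb hab).trans ?_
  gcongr <;> exact le_convexMinorant hk hkg _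

end Minorant

theorem _root_.ConvexOn.continuous_of_univ {f : ℝ → ℝ} (hf : ConvexOn ℝ univ f) : Continuous f :=
  continuousOn_univ.1 (hf.continuousOn isOpen_univ)

theorem convexOn_affine (a b : ℝ) : ConvexOn ℝ univ (fun x => a * x + b) := by
  refine ⟨convex_univ, fun x _ y _ s t _ _ hst => le_of_eq ?_⟩
  simp only [smul_eq_mul]
  linear_combination (-b) * hst

/-- Where the greatest convex minorant stays strictly below a continuous function, it lies locally
above its chords: the maximum with such a chord would otherwise be a larger convex minorant. -/
theorem exists_chord_le_convexMinorant {g h : ℝ → ℝ} (hc : ConvexOn ℝ univ h)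
    (hg : ∀ z, h z ≤ g z) (hgc : Continuous g) {t r : ℝ} (hr : 0 < r)
    (ht : convexMinorant g t < g t) :
    ∃ ε, 0 < ε ∧ ε < r ∧
      (convexMinorant g (t - ε) + convexMinorant g (t + ε)) / 2 ≤ convexMinorant g t := by
  set D := convexMinorant g with hDdef
  have hD : ConvexOn ℝ univ D := convexOn_convexMinorant hc hg
  have hDg : ∀ x, D x ≤ g x := convexMinorant_le hc hg
  obtain ⟨m, hm1, hm2⟩ := exists_between ht
  have e1 : ∀ᶠ x in 𝓝 t, D x < m ∧ m < g x :=
    (hD.continuous_of_univ.continuousAt.eventually_lt continuousAt_const hm1).and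
      (continuousAt_const.eventually_lt hgc.continuousAt hm2)
  obtain ⟨δ, hδ, hball⟩ := Metric.eventually_nhds_iff.1 e1
  set ε := min (δ / 2) (r / 2) with hε
  have hε0 : 0 < ε := by positivity
  have hεδ : ε < δ := (min_le_left _ _).trans_lt (by linarith)
  have hεr : ε < r := (min_le_right _ _).trans_lt (by linarith)
  have hnear : ∀ x, t - ε ≤ x → x ≤ t + ε → D x < m ∧ m < g x := fun x h1 h2 =>
    hball (by rw [Real.dist_eq]; exact (abs_le.2 ⟨by linarith, by linarith⟩).trans_lt hεδ)
  refine ⟨ε, hε0, hεr, ?_⟩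
  set q := (D (t + ε) - D (t - ε)) / (2 * ε) with hq
  have hqe : q * (2 * ε) = D (t + ε) - D (t - ε) := by rw [hq]; field_simp
  set L : ℝ → ℝ := fun x => q * x + (D (t - ε) - q * (t - ε)) with hL
  have hmax : ConvexOn ℝ univ (D ⊔ L) := hD.sup (convexOn_affine _ _)
  have hLg : ∀ x, L x ≤ g x := by
    intro x
    rcases lt_or_ge x (t - ε) with hx | hx
    · have := hD.slope_mono_adjacent (mem_univ x) (mem_univ (t + ε)) hx (by linarith)
      have h2 : (D (t + ε) - D (t - ε)) / (t + ε - (t - ε)) = q := by rw [hq]; congr 1; ring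
      rw [h2, div_le_iff₀ (by linarith)] at this
      refine le_trans ?_ (hDg x)
      simp only [hL]; linarith
    rcases lt_or_ge (t + ε) x with hx' | hx'
    · have := hD.slope_mono_adjacent (mem_univ (t - ε)) (mem_univ x) (by linarith) hx'
      have h2 : (D (t + ε) - D (t - ε)) / (t + ε - (t - ε)) = q := by rw [hq]; congr 1; ring
      rw [h2, le_div_iff₀ (by linarith)] at this
      refine le_trans ?_ (hDg x)
      simp only [hL]; linarith
    · refine le_trans ?_ (hnear x hx hx').2.le
      have h1 := (hnear (t - ε) le_rfl (by linarith)).1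
      have h2 := (hnear (t + ε) (by linarith) le_rfl).1
      simp only [hL]
      rcases le_total 0 q with h0 | h0
      · nlinarith [mul_le_mul_of_nonneg_left hx' h0]
      · nlinarith [mul_le_mul_of_nonpos_left hx h0]
  have := le_convexMinorant (g := g) hmax (fun z => sup_le (hDg z) (hLg z)) t
  have h3 : L t ≤ D t := le_trans le_sup_right this
  simp only [hL] at h3
  linarith

/-- If `P` and `Q` are convex, then subtracting from `P` the greatest convex minorant of `P - Q`
leaves a convex function. At a point of contact the difference equals `Q` and lies above `Q`
elsewhere; off the contact set the minorant is affine. -/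
theorem convexOn_sub_convexMinorant {P Q : ℝ → ℝ} (hP : ConvexOn ℝ univ P)
    (hQ : ConvexOn ℝ univ Q) {h : ℝ → ℝ} (hc : ConvexOn ℝ univ h) (hh : ∀ z, h z ≤ P z - Q z) :
    ConvexOn ℝ univ (fun x => P x - convexMinorant (fun z => P z - Q z) x) := by
  set D := convexMinorant (fun z => P z - Q z) with hDdef
  have hD : ConvexOn ℝ univ D := convexOn_convexMinorant hc hh
  have hDg : ∀ x, D x ≤ P x - Q x := convexMinorant_le hc hh
  refine convexOn_of_slope_mono_adjacent convex_univ fun {u k v} _ _ huk hkv => ?_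
  by_contra! hcon
  have huv : u < v := huk.trans hkv
  set p := ((P v - D v) - (P u - D u)) / (v - u) with hp
  have hpe : p * (v - u) = (P v - D v) - (P u - D u) := by
    rw [hp]; exact div_mul_cancel₀ _ (by linarith)
  set φ : ℝ → ℝ := fun x => P x - D x - p * x with hφ
  have hφc : Continuous φ :=
    (hP.continuous_of_univ.sub hD.continuous_of_univ).sub (continuous_const.mul continuous_id)
  have hφuv : φ v = φ u := by simp only [hφ]; linarith
  have hφk : φ u < φ k := by
    rw [div_lt_div_iff₀ (by linarith) (by linarith)] at hcon
    simp only [hφ]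
    have e : ((P k - D k) - (P u - D u) - p * (k - u)) * (v - u) > 0 := by
      have : ((P k - D k) - (P u - D u) - p * (k - u)) * (v - u)
        = ((P k - D k) - (P u - D u)) * (v - u) - (p * (v - u)) * (k - u) := by ring
      rw [this, hpe]
      nlinarith
    have := pos_of_mul_pos_left e (by linarith)
    linarith
  obtain ⟨t₀, ht₀, hmax⟩ := isCompact_Icc.exists_isMaxOn (nonempty_Icc.2 huv.le) hφc.continuousOn
  -- the leftmost maximiser on `[u, v]`
  have hS : IsCompact (Icc u v ∩ φ ⁻¹' {φ t₀}) :=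
    isCompact_Icc.inter_right (isClosed_singleton.preimage hφc)
  obtain ⟨t, ⟨htm, hte⟩, hleast⟩ := hS.exists_isLeast ⟨t₀, ht₀, rfl⟩
  replace hte : φ t = φ t₀ := hte
  have hle : ∀ x, u ≤ x → x ≤ v → φ x ≤ φ t := fun x h1 h2 => by
    rw [hte]; exact hmax ⟨h1, h2⟩
  have hut : φ u < φ t := hφk.trans_le (hle k huk.le hkv.le)
  have htu : u < t := lt_of_le_of_ne htm.1 (fun e => by rw [e] at hut; exact lt_irrefl _ hut)
  have htv : t < v := lt_of_le_of_ne htm.2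
    (fun e => by rw [e, hφuv] at hut; exact lt_irrefl _ hut)
  rcases eq_or_lt_of_le (hDg t) with heq | hlt
  · have hQ' : ConvexOn ℝ univ (fun x => Q x + ((-p) * x + 0)) := hQ.add (convexOn_affine _ _)
    have h1 := hQ'.le_max_of_mem_Icc (mem_univ u) (mem_univ v) htm
    have hu := hDg u
    have hv := hDg v
    have h2 : Q t + ((-p) * t + 0) = φ t := by simp only [hφ]; linarith
    have h3 : max (Q u + ((-p) * u + 0)) (Q v + ((-p) * v + 0)) ≤ φ u := by
      refine max_le ?_ ?_
      · simp only [hφ]; linarith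
      · rw [← hφuv]; simp only [hφ]; linarith
    exact absurd (h2 ▸ h1.trans h3) (not_le.2 hut)
  · obtain ⟨ε, hε, hεr, hch⟩ := exists_chord_le_convexMinorant hc hh
      (hP.continuous_of_univ.sub hQ.continuous_of_univ)
      (lt_min (sub_pos.2 htu) (sub_pos.2 htv)) hlt
    have h1 := hεr.trans_le (min_le_left _ _)
    have h2 := hεr.trans_le (min_le_right _ _)
    have hPm := hP.2 (mem_univ (t - ε)) (mem_univ (t + ε)) (by norm_num : (0:ℝ) ≤ 1 / 2)
      (by norm_num : (0:ℝ) ≤ 1 / 2) (by norm_num)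
    have hmid : (1 / 2 : ℝ) • (t - ε) + (1 / 2 : ℝ) • (t + ε) = t := by
      simp only [smul_eq_mul]; ring
    rw [hmid] at hPm
    simp only [smul_eq_mul] at hPm
    have ha := hle (t - ε) (by linarith) (by linarith)
    have hb := hle (t + ε) (by linarith) (by linarith)
    have hne : φ (t - ε) ≠ φ t := fun e => by
      have := hleast ⟨⟨by linarith, by linarith⟩, e.trans hte⟩
      linarith
    have ha' := lt_of_le_of_ne ha hne
    simp only [hφ] at ha' hb
    change (D (t - ε) + D (t + ε)) / 2 ≤ D t at hch
    linarith

/-! ### Right derivatives of convex functions -/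

/-- The right derivative of a function on the line, with junk value `0` where there is none; convex
functions have one everywhere. -/
noncomputable def rightDeriv (f : ℝ → ℝ) (x : ℝ) : ℝ := derivWithin f (Ioi x) x

section RightDeriv

variable {f : ℝ → ℝ}

theorem hasDerivWithinAt_rightDeriv (hf : ConvexOn ℝ univ f) (x : ℝ) :
    HasDerivWithinAt f (rightDeriv f x) (Ioi x) x :=
  hf.hasDerivWithinAt_rightDeriv_of_mem_interior (by simp)

theorem monotone_rightDeriv (hf : ConvexOn ℝ univ f) : Monotone (rightDeriv f) := by
  have := hf.monotoneOn_rightDeriv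
  rwa [interior_univ, monotoneOn_univ] at this

theorem rightDeriv_mul_le (hf : ConvexOn ℝ univ f) {x y : ℝ} (hxy : x ≤ y) :
    rightDeriv f x * (y - x) ≤ f y - f x := by
  rcases hxy.eq_or_lt with rfl | hlt
  · simp
  have := hf.rightDeriv_le_slope_of_mem_interior (x := x) (by simp) (mem_univ y) hlt
  rw [slope_def_field, le_div_iff₀ (by linarith)] at this
  exact this

theorem sub_le_rightDeriv_mul (hf : ConvexOn ℝ univ f) {x y : ℝ} (hxy : x ≤ y) :
    f y - f x ≤ rightDeriv f y * (y - x) := by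
  rcases hxy.eq_or_lt with rfl | hlt
  · simp
  have h1 := hf.slope_le_leftDeriv_of_mem_interior (x := x) (y := y) (mem_univ x) (by simp) hlt
  have h2 := hf.leftDeriv_le_rightDeriv_of_mem_interior (x := y) (by simp)
  have := h1.trans h2
  rw [slope_def_field, div_le_iff₀ (by linarith)] at this
  exact this

theorem rightDeriv_mul_le_sub (hf : ConvexOn ℝ univ f) (x y : ℝ) :
    rightDeriv f x * (y - x) ≤ f y - f x := by
  rcases le_total x y with h | h
  · exact rightDeriv_mul_le hf h
  · linarith [sub_le_rightDeriv_mul hf h]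

theorem integral_rightDeriv (hf : ConvexOn ℝ univ f) (a b : ℝ) :
    ∫ x in a..b, rightDeriv f x = f b - f a :=
  intervalIntegral.integral_eq_sub_of_hasDeriv_right hf.continuous_of_univ.continuousOn
    (fun x _ => hasDerivWithinAt_rightDeriv hf x)
    (monotone_rightDeriv hf).intervalIntegrable

end RightDeriv

theorem exists_rightDeriv_lt {f g : ℝ → ℝ} (hf : ConvexOn ℝ univ f) (hg : ConvexOn ℝ univ g)
    {x y : ℝ} (hxy : x ≤ y) (hlt : g y - g x < f y - f x) : ∃ t, rightDeriv g t < rightDeriv f t := by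
  by_contra! hcon
  have := intervalIntegral.integral_mono_on (μ := volume) hxy
    (monotone_rightDeriv hf).intervalIntegrable (monotone_rightDeriv hg).intervalIntegrable
    (fun t _ => hcon t)
  rw [integral_rightDeriv hf, integral_rightDeriv hg] at this
  linarith

/-- A function and its greatest convex minorant have the same affine minorants. -/
theorem exists_lt_of_convexMinorant_lt {g : ℝ → ℝ} {p c k : ℝ} (hk : convexMinorant g k < p * k + c) :
    ∃ z, g z < p * z + c := by
  by_contra! hcon
  exact absurd (le_convexMinorant (convexOn_affine p c) hcon k) (not_le.2 hk)

/-- Taking greatest convex minorants preserves the order of the derivatives: if `g₂ - g₁` is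
non-decreasing, so is the difference of the minorants. Otherwise some slope `p` lies between the
right derivatives of the minorants at some point `t`, in the wrong order. Then `g₁ - p x` is close
to its infimum only to the left of `t` and `g₂ - p x` only to the right of `t`. -/
theorem monotone_convexMinorant_sub {g₁ g₂ h₁ h₂ : ℝ → ℝ} (hc₁ : ConvexOn ℝ univ h₁)
    (hg₁ : ∀ z, h₁ z ≤ g₁ z) (hc₂ : ConvexOn ℝ univ h₂) (hg₂ : ∀ z, h₂ z ≤ g₂ z)
    (hmono : Monotone (fun x => g₂ x - g₁ x)) :
    Monotone (fun x => convexMinorant g₂ x - convexMinorant g₁ x) := by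
  intro x y hxy
  by_contra! hcon
  have hD₁ := convexOn_convexMinorant hc₁ hg₁
  have hD₂ := convexOn_convexMinorant hc₂ hg₂
  have hl₁ := convexMinorant_le hc₁ hg₁
  have hl₂ := convexMinorant_le hc₂ hg₂
  obtain ⟨s, hs⟩ := exists_rightDeriv_lt hD₁ hD₂ hxy (by linarith)
  have hsl₁ := hasDerivWithinAt_rightDeriv hD₁ s
  have hsl₂ := hasDerivWithinAt_rightDeriv hD₂ s
  set D₁ := convexMinorant g₁
  set D₂ := convexMinorant g₂
  obtain ⟨p, hp₂, hp₁⟩ := exists_between hs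
  -- a point `v > s` with `D₂ v - p v < D₂ s - p s`
  have hev : ∀ᶠ v in 𝓝[>] s, slope D₂ s v < p :=
    ((hasDerivWithinAt_iff_tendsto_slope' self_notMem_Ioi).1 hsl₂).eventually_lt_const hp₂
  obtain ⟨v, hv, hsv⟩ := (hev.and self_mem_nhdsWithin).exists
  replace hsv : s < v := hsv
  rw [slope_def_field, div_lt_iff₀ (by linarith)] at hv
  -- by continuity the same holds with some `t ∈ (s, v)` in place of `s`
  have hcont : Continuous (fun t => D₂ t - p * t) :=
    hD₂.continuous_of_univ.sub (continuous_const.mul continuous_id)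
  have hev' : ∀ᶠ t in 𝓝[>] s, D₂ v - p * v < D₂ t - p * t :=
    nhdsWithin_le_nhds (hcont.continuousAt.eventually_const_lt (by linarith))
  obtain ⟨t, ht, hst, htv⟩ := (hev'.and (Ioo_mem_nhdsGT hsv)).exists
  -- `D₁ x - p x` is strictly below its value at `t` at `s`, and above to the right of `t`
  have hts : D₁ s - p * s < D₁ t - p * t := by
    have := rightDeriv_mul_le hD₁ hst.le
    nlinarith
  have hright : ∀ z, t ≤ z → D₁ t - p * t ≤ D₁ z - p * z := by
    intro z hz
    have h1 := rightDeriv_mul_le hD₁ hz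
    have h2 := monotone_rightDeriv hD₁ hst.le
    nlinarith
  have hleft : ∀ z, z ≤ t → D₂ t - p * t ≤ D₂ z - p * z := by
    intro z hz
    have h1 := rightDeriv_mul_le hD₂ htv.le
    have h2 := sub_le_rightDeriv_mul hD₂ hz
    have h3 : rightDeriv D₂ t < p := by
      by_contra! h
      nlinarith
    nlinarith
  obtain ⟨k₁, hk₁⟩ := exists_lt_of_convexMinorant_lt (p := p) (c := D₁ t - p * t) (k := s)
    (by change D₁ s < _; linarith)
  obtain ⟨k₂, hk₂⟩ := exists_lt_of_convexMinorant_lt (p := p) (c := D₂ t - p * t) (k := v)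
    (by change D₂ v < _; linarith)
  have hk₁t : k₁ < t := by
    by_contra! h
    have h1 := hright k₁ h
    have h2 : D₁ k₁ ≤ g₁ k₁ := hl₁ k₁
    linarith
  have hk₂t : t < k₂ := by
    by_contra! h
    have h1 := hleft k₂ h
    have h2 : D₂ k₂ ≤ g₂ k₂ := hl₂ k₂
    linarith
  have h1 := hright k₂ hk₂t.le
  have h2 := hleft k₁ hk₁t.le
  have h3 : D₁ k₂ ≤ g₁ k₂ := hl₁ k₂
  have h4 : D₂ k₁ ≤ g₂ k₁ := hl₂ k₁
  have h5 := hmono (hk₁t.trans hk₂t).le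
  linarith

/-! ### Put potentials -/

/-- The put potential `k ↦ ∫ (k - x)⁺ dη(x)` of a measure on the line. -/
noncomputable def potential (η : Measure ℝ) (k : ℝ) : ℝ := ∫ x, max (k - x) 0 ∂η

/-- The distribution function of a finite measure on the line, which increases from `0` to the mass
of the measure. -/
noncomputable def distribution (η : Measure ℝ) (t : ℝ) : ℝ := η.real (Iic t)

section Potential

variable {η χ : Measure ℝ}

theorem integrable_put (hη : FiniteFirstMoment η) (k : ℝ) :
    Integrable (fun x => max (k - x) 0) η := by
  have := hη.1
  exact ((integrable_const k).sub hη.2).pos_part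

theorem convexOn_put (k : ℝ) : ConvexOn ℝ univ (fun x : ℝ => max (k - x) 0) := by
  have h1 : ConvexOn ℝ univ (fun x : ℝ => (-1) * x + k) := convexOn_affine _ _
  have h2 : ConvexOn ℝ univ (fun x : ℝ => 0 * x + 0) := convexOn_affine _ _
  have e : (fun x : ℝ => max (k - x) 0) = (fun x => (-1) * x + k) ⊔ fun x => 0 * x + 0 := by
    ext x
    rw [Pi.sup_apply]
    congr 1 <;> ring
  rw [e]
  exact h1.sup h2

theorem antitone_put (k : ℝ) : Antitone (fun x : ℝ => max (k - x) 0) := fun _ _ h =>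
  max_le_max (by linarith) le_rfl

theorem FiniteFirstMoment.mono (hχ : FiniteFirstMoment χ) (h : η ≤ χ) : FiniteFirstMoment η := by
  have := hχ.1
  exact ⟨isFiniteMeasure_of_le χ h, hχ.2.mono_measure h⟩

theorem potential_nonneg (k : ℝ) : 0 ≤ potential η k :=
  integral_nonneg fun _ => le_max_right _ _

theorem convexOn_potential (hη : FiniteFirstMoment η) : ConvexOn ℝ univ (potential η) := by
  refine ⟨convex_univ, fun x _ y _ a b ha hb hab => ?_⟩
  simp only [potential, smul_eq_mul]
  rw [← integral_const_mul, ← integral_const_mul,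
    ← integral_add ((integrable_put hη x).const_mul a) ((integrable_put hη y).const_mul b)]
  refine integral_mono (integrable_put hη _)
    (((integrable_put hη x).const_mul a).add ((integrable_put hη y).const_mul b)) fun z => ?_
  refine max_le ?_ ?_
  · have h1 := mul_le_mul_of_nonneg_left (le_max_left (x - z) 0) ha
    have h2 := mul_le_mul_of_nonneg_left (le_max_left (y - z) 0) hb
    have : a * x + b * y - z = a * (x - z) + b * (y - z) := by linear_combination z * hab
    linarith
  · have h1 := mul_nonneg ha (le_max_right (x - z) 0)
    have h2 := mul_nonneg hb (le_max_right (y - z) 0)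
    linarith

theorem potential_add_measure (hη : FiniteFirstMoment η) (hχ : FiniteFirstMoment χ) (k : ℝ) :
    potential (η + χ) k = potential η k + potential χ k :=
  integral_add_measure (integrable_put hη k) (integrable_put hχ k)

theorem tendsto_potential_atBot (hη : FiniteFirstMoment η) :
    Tendsto (potential η) atBot (𝓝 0) := by
  have := hη.1
  have key : Tendsto (fun k => ∫ x, max (k - x) 0 ∂η) atBot (𝓝 (∫ _, (0 : ℝ) ∂η)) := by
    refine tendsto_integral_filter_of_dominated_convergence (fun x => |x|)
      (Eventually.of_forall fun k => (integrable_put hη k).aestronglyMeasurable) ?_ hη.2.abs ?_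
    · filter_upwards [eventually_le_atBot (0 : ℝ)] with k hk
      refine Eventually.of_forall fun x => ?_
      rw [Real.norm_eq_abs, abs_of_nonneg (le_max_right _ _)]
      exact max_le (by linarith [neg_abs_le x]) (abs_nonneg x)
    · refine Eventually.of_forall fun x => tendsto_const_nhds.congr' ?_
      filter_upwards [eventually_le_atBot x] with k hk
      rw [max_eq_right (by linarith)]
  rw [integral_zero] at key
  exact key

theorem mass_mul_sub_le_potential (hη : FiniteFirstMoment η) (k : ℝ) :
    η.real univ * k - ∫ x, x ∂η ≤ potential η k := by
  have := hη.1
  have h1 : ∫ x, (k - x) ∂η = η.real univ * k - ∫ x, x ∂η := by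
    rw [integral_sub (integrable_const k) hη.2, integral_const, smul_eq_mul]
  rw [← h1]
  exact integral_mono ((integrable_const k).sub hη.2) (integrable_put hη k)
    fun x => le_max_left _ _

theorem potential_le_mass_mul_add (hη : FiniteFirstMoment η) {k : ℝ} (hk : 0 ≤ k) :
    potential η k ≤ η.real univ * k + ∫ x, |x| ∂η := by
  have := hη.1
  have h1 : ∫ x, (k + |x|) ∂η = η.real univ * k + ∫ x, |x| ∂η := by
    rw [integral_add (integrable_const k) hη.2.abs, integral_const, smul_eq_mul]
  rw [← h1]
  exact integral_mono (integrable_put hη k) ((integrable_const k).add hη.2.abs)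
    fun x => max_le (by linarith [neg_abs_le x]) (by positivity)

/-- The mass is the asymptotic slope of the potential at `+∞`. -/
theorem le_mass_of_le_potential (hη : FiniteFirstMoment η) {a c : ℝ}
    (h : ∀ k, 0 ≤ k → a * k - c ≤ potential η k) : a ≤ η.real univ := by
  by_contra! hlt
  set C := c + ∫ x, |x| ∂η with hC
  have key : ∀ k, 0 ≤ k → (a - η.real univ) * k ≤ C := fun k hk => by
    have h1 := h k hk
    have h2 := potential_le_mass_mul_add hη hk
    linarith
  have hpos : 0 < a - η.real univ := by linarith
  have := key ((|C| + 1) / (a - η.real univ)) (by positivity)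
  rw [mul_div_cancel₀ _ hpos.ne'] at this
  linarith [le_abs_self C]

/-- Tonelli's theorem for the tail integral `x ↦ ∫ₓ^∞ w`. -/
theorem lintegral_lintegral_Ici [SFinite η] {w : ℝ → ENNReal} (hw : Measurable w) :
    ∫⁻ x, (∫⁻ t in Ici x, w t) ∂η = ∫⁻ t, η (Iic t) * w t := by
  have hm : MeasurableSet {p : ℝ × ℝ | p.1 ≤ p.2} := measurableSet_le measurable_fst measurable_snd
  have h1 : ∀ x, ∫⁻ t in Ici x, w t
      = ∫⁻ t, {p : ℝ × ℝ | p.1 ≤ p.2}.indicator (fun p => w p.2) (x, t) := fun x => by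
    rw [← lintegral_indicator measurableSet_Ici]
    rfl
  rw [lintegral_congr h1, lintegral_lintegral_swap]
  · refine lintegral_congr fun t => ?_
    have : (fun x => {p : ℝ × ℝ | p.1 ≤ p.2}.indicator (fun p => w p.2) (x, t))
        = (Iic t).indicator (fun _ => w t) := by
      ext x; rfl
    rw [this, lintegral_indicator_const measurableSet_Iic, mul_comm]
  · exact ((hw.comp measurable_snd).indicator hm).aemeasurable

theorem ofReal_potential (hη : FiniteFirstMoment η) (k : ℝ) :
    ENNReal.ofReal (potential η k) = ∫⁻ t in Iic k, η (Iic t) := by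
  have := hη.1
  rw [potential, ofReal_integral_eq_lintegral_ofReal (integrable_put hη k)
    (Eventually.of_forall fun x => le_max_right _ _)]
  have h1 : ∀ x, ENNReal.ofReal (max (k - x) 0)
      = ∫⁻ t in Ici x, (Iic k).indicator (fun _ => (1 : ENNReal)) t := fun x => by
    rw [lintegral_indicator_const measurableSet_Iic, Measure.restrict_apply measurableSet_Iic,
      one_mul, inter_comm, Ici_inter_Iic, Real.volume_Icc, ENNReal.ofReal_max]
    simp
  have h2 := lintegral_lintegral_Ici (η := η) (w := (Iic k).indicator fun _ => (1 : ENNReal))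
    (measurable_const.indicator measurableSet_Iic)
  rw [lintegral_congr h1, h2, ← lintegral_indicator measurableSet_Iic]
  refine lintegral_congr fun t => ?_
  by_cases ht : t ∈ Iic k <;> simp [ht]

theorem monotone_distribution [IsFiniteMeasure η] : Monotone (distribution η) :=
  fun _ _ h => measureReal_mono (Iic_subset_Iic.2 h)

theorem distribution_nonneg (t : ℝ) : 0 ≤ distribution η t := measureReal_nonneg

theorem ofReal_distribution [IsFiniteMeasure η] (t : ℝ) :
    ENNReal.ofReal (distribution η t) = η (Iic t) := ofReal_measureReal

theorem distribution_add [IsFiniteMeasure η] [IsFiniteMeasure χ] (t : ℝ) :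
    distribution (η + χ) t = distribution η t + distribution χ t :=
  measureReal_add_apply

theorem integrableOn_distribution (hη : FiniteFirstMoment η) (k : ℝ) :
    IntegrableOn (distribution η) (Iic k) := by
  have := hη.1
  refine ⟨monotone_distribution.measurable.aestronglyMeasurable, ?_⟩
  rw [hasFiniteIntegral_iff_ofReal (Eventually.of_forall fun t => distribution_nonneg t)]
  simp_rw [ofReal_distribution]
  rw [← ofReal_potential hη]
  exact ENNReal.ofReal_lt_top

theorem potential_eq_integral (hη : FiniteFirstMoment η) (k : ℝ) :
    potential η k = ∫ t in Iic k, distribution η t := by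
  have := hη.1
  rw [← ENNReal.ofReal_eq_ofReal_iff (potential_nonneg k)
    (integral_nonneg fun t => distribution_nonneg t), ofReal_potential hη,
    ofReal_integral_eq_lintegral_ofReal (integrableOn_distribution hη k)
      (Eventually.of_forall fun t => distribution_nonneg t)]
  simp_rw [ofReal_distribution]

theorem potential_sub_potential (hη : FiniteFirstMoment η) (a b : ℝ) :
    potential η b - potential η a = ∫ t in a..b, distribution η t := by
  rw [potential_eq_integral hη, potential_eq_integral hη]
  exact intervalIntegral.integral_Iic_sub_Iic (integrableOn_distribution hη a)
    (integrableOn_distribution hη b)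

theorem distribution_rightContinuous [IsFiniteMeasure η] (a : ℝ) :
    Tendsto (distribution η) (𝓝[>] a) (𝓝 (distribution η a)) := by
  have h := tendsto_measure_biInter_gt (μ := η) (s := fun t : ℝ => Iic t) (a := a)
    (fun r _ => measurableSet_Iic.nullMeasurableSet) (fun i j _ hij => Iic_subset_Iic.2 hij)
    ⟨a + 1, by simp, measure_ne_top _ _⟩
  have e : (⋂ r > a, Iic r) = Iic a := by
    ext x
    simp only [mem_iInter, mem_Iic]
    exact ⟨fun h => le_of_forall_gt_imp_ge_of_dense h, fun h r hr => h.trans (le_of_lt hr)⟩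
  rw [e] at h
  exact (ENNReal.tendsto_toReal (measure_ne_top η _)).comp h

theorem tendsto_distribution_atBot [IsFiniteMeasure η] :
    Tendsto (distribution η) atBot (𝓝 0) := by
  have h := tendsto_measure_iInter_atBot (μ := η) (s := fun t : ℝ => Iic t)
    (fun r => measurableSet_Iic.nullMeasurableSet) (fun i j hij => Iic_subset_Iic.2 hij)
    ⟨0, measure_ne_top _ _⟩
  have e : (⋂ r : ℝ, Iic r) = ∅ := by
    ext x
    simp only [mem_iInter, mem_Iic, mem_empty_iff_false, iff_false, not_forall, not_le]
    exact exists_lt x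
  rw [e, measure_empty] at h
  exact (ENNReal.tendsto_toReal ENNReal.zero_ne_top).comp h

theorem distribution_mul_le (hη : FiniteFirstMoment η) {a b : ℝ} (hab : a ≤ b) :
    distribution η a * (b - a) ≤ potential η b - potential η a := by
  have := hη.1
  rw [potential_sub_potential hη]
  have := intervalIntegral.integral_mono_on (μ := volume) hab (f := fun _ => distribution η a)
    intervalIntegrable_const
    monotone_distribution.intervalIntegrable (fun t ht => monotone_distribution (η := η) ht.1)
  rw [intervalIntegral.integral_const, smul_eq_mul] at this
  linarith

theorem potential_sub_le (hη : FiniteFirstMoment η) {a b : ℝ} (hab : a ≤ b) :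
    potential η b - potential η a ≤ distribution η b * (b - a) := by
  have := hη.1
  rw [potential_sub_potential hη]
  have := intervalIntegral.integral_mono_on (μ := volume) hab (g := fun _ => distribution η b)
    monotone_distribution.intervalIntegrable
    intervalIntegrable_const (fun t ht => monotone_distribution (η := η) ht.2)
  rw [intervalIntegral.integral_const, smul_eq_mul] at this
  linarith

theorem hasDerivWithinAt_potential (hη : FiniteFirstMoment η) (a : ℝ) :
    HasDerivWithinAt (potential η) (distribution η a) (Ioi a) a := by
  have := hη.1
  rw [hasDerivWithinAt_iff_tendsto_slope' self_notMem_Ioi]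
  refine tendsto_of_tendsto_of_tendsto_of_le_of_le' tendsto_const_nhds
    (distribution_rightContinuous a) ?_ ?_
  · filter_upwards [self_mem_nhdsWithin] with b hb
    replace hb : a < b := hb
    rw [slope_def_field, le_div_iff₀ (by linarith)]
    exact distribution_mul_le hη hb.le
  · filter_upwards [self_mem_nhdsWithin] with b hb
    replace hb : a < b := hb
    rw [slope_def_field, div_le_iff₀ (by linarith)]
    exact potential_sub_le hη hb.le

theorem rightDeriv_potential (hη : FiniteFirstMoment η) (a : ℝ) :
    rightDeriv (potential η) a = distribution η a :=
  (hasDerivWithinAt_potential hη a).derivWithin (uniqueDiffWithinAt_Ioi a)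

theorem eq_of_potential_eq (hη : FiniteFirstMoment η) (hχ : FiniteFirstMoment χ)
    (h : potential η = potential χ) : η = χ := by
  have := hη.1
  have := hχ.1
  refine Measure.ext_of_Iic _ _ fun a => ?_
  rw [← ofReal_distribution, ← ofReal_distribution, ← rightDeriv_potential hη,
    ← rightDeriv_potential hχ, h]

end Potential

/-! ### The convex-decreasing order through potentials -/

section Order

variable {η χ : Measure ℝ}

theorem PosConvexDecreasingLE.mass_le (hχ : FiniteFirstMoment χ)
    (h : PosConvexDecreasingLE η χ) : η.real univ ≤ χ.real univ := by
  have := hχ.1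
  have h1 := h (fun _ => 1) (fun _ => zero_le_one) (convexOn_const _ convex_univ) antitone_const
  simp only [ENNReal.ofReal_one, lintegral_one] at h1
  exact ENNReal.toReal_mono (measure_ne_top _ _) h1

theorem PosConvexDecreasingLE.potential_le (hη : FiniteFirstMoment η) (hχ : FiniteFirstMoment χ)
    (h : PosConvexDecreasingLE η χ) (k : ℝ) : potential η k ≤ potential χ k := by
  have h1 := h _ (fun x => le_max_right _ _) (convexOn_put k) (antitone_put k)
  rw [← ofReal_integral_eq_lintegral_ofReal (integrable_put hη k)
      (Eventually.of_forall fun x => le_max_right _ _),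
    ← ofReal_integral_eq_lintegral_ofReal (integrable_put hχ k)
      (Eventually.of_forall fun x => le_max_right _ _),
    ENNReal.ofReal_le_ofReal_iff (integral_nonneg fun x : ℝ => le_max_right (k - x) 0)] at h1
  exact h1

theorem ConvexDecreasingLE.potential_le (hχ : FiniteFirstMoment χ)
    (h : ConvexDecreasingLE η χ) (k : ℝ) : potential η k ≤ potential χ k :=
  (h _ (convexOn_put k) (antitone_put k) (integrable_put hχ k)).2

theorem ConvexDecreasingLE.mass_eq (hχ : FiniteFirstMoment χ)
    (h : ConvexDecreasingLE η χ) : η.real univ = χ.real univ := by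
  have := hχ.1
  have h1 := (h (fun _ => 1) (convexOn_const _ convex_univ) antitone_const
    (integrable_const _)).2
  have h2 := (h (fun _ => -1) (convexOn_const _ convex_univ) antitone_const
    (integrable_const _)).2
  simp only [integral_const, smul_eq_mul, mul_one, mul_neg] at h1 h2
  linarith

/-- If the potentials are ordered, then so are the integrals of the distribution functions against
any antitone weight: by the layer cake formula it suffices to treat weights that are indicators of
lower sets. -/
theorem lintegral_mul_le_of_potential_le (hη : FiniteFirstMoment η) (hχ : FiniteFirstMoment χ)
    (h : ∀ k, potential η k ≤ potential χ k) {w : ℝ → ℝ} (hw : Antitone w) (hw0 : ∀ t, 0 ≤ w t) :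
    ∫⁻ t, η (Iic t) * ENNReal.ofReal (w t) ≤ ∫⁻ t, χ (Iic t) * ENNReal.ofReal (w t) := by
  have hm : ∀ ζ : Measure ℝ, Measurable fun t : ℝ => ζ (Iic t) := fun ζ =>
    (show Monotone fun t : ℝ => ζ (Iic t) from
      fun _ _ h => measure_mono (Iic_subset_Iic.2 h)).measurable
  have hwm : Measurable fun t => ENNReal.ofReal (w t) := hw.measurable.ennreal_ofReal
  have hd : ∀ ζ : Measure ℝ, ∫⁻ t, ζ (Iic t) * ENNReal.ofReal (w t)
      = ∫⁻ t, ENNReal.ofReal (w t) ∂(volume.withDensity fun t => ζ (Iic t)) := fun ζ => by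
    rw [lintegral_withDensity_eq_lintegral_mul _ (hm ζ) hwm]
    rfl
  have hIic : ∀ k, (volume.withDensity fun t => η (Iic t)) (Iic k)
      ≤ (volume.withDensity fun t => χ (Iic t)) (Iic k) := fun k => by
    rw [withDensity_apply _ measurableSet_Iic, withDensity_apply _ measurableSet_Iic,
      ← ofReal_potential hη, ← ofReal_potential hχ]
    exact ENNReal.ofReal_le_ofReal (h k)
  rw [hd, hd, lintegral_eq_lintegral_meas_lt _ (Eventually.of_forall hw0) hw.measurable.aemeasurable,
    lintegral_eq_lintegral_meas_lt _ (Eventually.of_forall hw0) hw.measurable.aemeasurable]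
  refine lintegral_mono fun u => ?_
  have hlow : IsLowerSet {a | u < w a} := fun a b hba ha => lt_of_lt_of_le ha (hw hba)
  rcases eq_empty_or_nonempty {a | u < w a} with e | hne
  · simp [e]
  by_cases hb : BddAbove {a | u < w a}
  · set τ := sSup {a | u < w a}
    have h1 : {a | u < w a} ⊆ Iic τ := fun a ha => le_csSup hb ha
    have h2 : Iio τ ⊆ {a | u < w a} := fun a ha => by
      obtain ⟨c, hc, hac⟩ := exists_lt_of_lt_csSup hne ha
      exact hlow hac.le hc
    have hnull : (volume.withDensity fun t => χ (Iic t)) (Iio τ)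
        = (volume.withDensity fun t => χ (Iic t)) (Iic τ) :=
      measure_congr ((withDensity_absolutelyContinuous _ _).ae_le Iio_ae_eq_Iic)
    calc _ ≤ _ := measure_mono h1
      _ ≤ _ := hIic τ
      _ = _ := hnull.symm
      _ ≤ _ := measure_mono h2
  · have e : {a | u < w a} = univ := by
      refine eq_univ_of_forall fun a => ?_
      obtain ⟨c, hc, hac⟩ := not_bddAbove_iff.1 hb a
      exact hlow hac.le hc
    rw [e]
    exact le_of_tendsto_of_tendsto' (tendsto_measure_Iic_atTop _) (tendsto_measure_Iic_atTop _) hIic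

theorem tendsto_potential_sub_atTop (hη : FiniteFirstMoment η) :
    Tendsto (fun k => potential η k - η.real univ * k) atTop (𝓝 (-∫ x, x ∂η)) := by
  have := hη.1
  have key : Tendsto (fun k => ∫ x, (max (k - x) 0 - k) ∂η) atTop (𝓝 (∫ x, -x ∂η)) := by
    refine tendsto_integral_filter_of_dominated_convergence (fun x => |x|)
      (Eventually.of_forall fun k =>
        ((integrable_put hη k).sub (integrable_const k)).aestronglyMeasurable) ?_ hη.2.abs ?_
    · filter_upwards [eventually_ge_atTop (0 : ℝ)] with k hk
      refine Eventually.of_forall fun x => ?_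
      rw [Real.norm_eq_abs, abs_le]
      rcases max_cases (k - x) 0 with ⟨h1, h2⟩ | ⟨h1, h2⟩ <;> rw [h1] <;>
        constructor <;> linarith [neg_abs_le x, le_abs_self x]
    · refine Eventually.of_forall fun x => tendsto_const_nhds.congr' ?_
      filter_upwards [eventually_ge_atTop x] with k hk
      rw [max_eq_left (by linarith)]
      ring
  rw [integral_neg] at key
  refine key.congr fun k => ?_
  rw [integral_sub (integrable_put hη k) (integrable_const k), integral_const, smul_eq_mul]
  rfl

theorem mean_le_of_potential_le (hη : FiniteFirstMoment η) (hχ : FiniteFirstMoment χ)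
    (hmass : η.real univ = χ.real univ) (h : ∀ k, potential η k ≤ potential χ k) :
    ∫ x, x ∂χ ≤ ∫ x, x ∂η := by
  have := le_of_tendsto_of_tendsto' (tendsto_potential_sub_atTop hη)
    (tendsto_potential_sub_atTop hχ) (fun k => by rw [hmass]; linarith [h k])
  linarith

/-- The excess over the tangent at `b` of a convex function, set to `0` to the right of `b`, is the
tail integral of an antitone weight. -/
theorem lintegral_Ici_rightDeriv {f : ℝ → ℝ} (hf : ConvexOn ℝ univ f) (b x : ℝ) :
    ∫⁻ t in Ici x, ENNReal.ofReal (max (rightDeriv f b - rightDeriv f t) 0)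
      = ENNReal.ofReal (f (min x b) - f b + rightDeriv f b * (b - min x b)) := by
  set y := min x b with hy
  have hyb : y ≤ b := min_le_right _ _
  have hp := monotone_rightDeriv hf
  have hint : ∀ c, IntervalIntegrable (fun t => rightDeriv f c - rightDeriv f t) volume y b :=
    fun c => intervalIntegrable_const.sub hp.intervalIntegrable
  have e1 : ∫ t in y..b, (rightDeriv f b - rightDeriv f t)
      = f y - f b + rightDeriv f b * (b - y) := by
    rw [intervalIntegral.integral_sub intervalIntegrable_const hp.intervalIntegrable,
      integral_rightDeriv hf, intervalIntegral.integral_const, smul_eq_mul]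
    ring
  rw [← e1, intervalIntegral.integral_of_le hyb, ofReal_integral_eq_lintegral_ofReal
    ((intervalIntegrable_iff_integrableOn_Ioc_of_le hyb).1 (hint b))
    ((ae_restrict_iff' measurableSet_Ioc).2
      (Eventually.of_forall fun t ht => sub_nonneg.2 (hp ht.2))),
    ← lintegral_indicator measurableSet_Ici, ← lintegral_indicator measurableSet_Ioc]
  refine lintegral_congr_ae ?_
  filter_upwards [compl_mem_ae_iff.2 (measure_singleton x), compl_mem_ae_iff.2 (measure_singleton b)]
    with t htx htb
  rcases lt_or_ge b t with h | h
  · have : rightDeriv f b - rightDeriv f t ≤ 0 := sub_nonpos.2 (hp h.le)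
    rw [indicator_of_notMem (fun h' : t ∈ Ioc y b => absurd h'.2 (not_le.2 h))]
    simp only [indicator]
    simp [max_eq_right this]
  · have htb' : t < b := lt_of_le_of_ne h htb
    have : 0 ≤ rightDeriv f b - rightDeriv f t := sub_nonneg.2 (hp h)
    by_cases hx : x ≤ t
    · have hxt : x < t := lt_of_le_of_ne hx (fun e => htx e.symm)
      rw [indicator_of_mem (show t ∈ Ici x from hx),
        indicator_of_mem (show t ∈ Ioc y b from ⟨(min_le_left _ _).trans_lt hxt, h⟩),
        max_eq_left this]
    · rw [indicator_of_notMem (show t ∉ Ici x from hx), indicator_of_notMem]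
      exact fun h' => absurd h'.1 (not_lt.2 (le_min (not_le.1 hx).le htb'.le))

/-- Equal mass and ordered potentials imply the convex-decreasing order. A convex antitone `f` is
the increasing limit of the functions that follow `f` up to `n` and its tangent at `n` afterwards. -/
theorem convexDecreasingLE_of_potential_le (hη : FiniteFirstMoment η) (hχ : FiniteFirstMoment χ)
    (hmass : η.real univ = χ.real univ) (h : ∀ k, potential η k ≤ potential χ k) :
    ConvexDecreasingLE η χ := by
  intro f hf hanti hfχ
  have := hη.1
  have := hχ.1
  have hmean := mean_le_of_potential_le hη hχ hmass h
  have hp := monotone_rightDeriv hf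
  have hp0 : ∀ b, rightDeriv f b ≤ 0 := fun b => by
    have h1 := rightDeriv_mul_le hf (x := b) (y := b + 1) (by linarith)
    have h2 := hanti (show b ≤ b + 1 by linarith)
    linarith
  -- the tangent at `b` and the excess over it
  set l : ℝ → ℝ → ℝ := fun b x => f b + rightDeriv f b * (x - b) with hl
  set e : ℝ → ℝ → ℝ := fun b x => f (min x b) - f b + rightDeriv f b * (b - min x b) with he
  have hlint : ∀ ζ : Measure ℝ, FiniteFirstMoment ζ → ∀ b, Integrable (l b) ζ := fun ζ hζ b => by
    have := hζ.1
    exact (integrable_const _).add ((hζ.2.sub (integrable_const b)).const_mul _)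
  have hlval : ∀ ζ : Measure ℝ, FiniteFirstMoment ζ → ∀ b, ∫ x, l b x ∂ζ
      = ζ.real univ * f b + rightDeriv f b * (∫ x, x ∂ζ - ζ.real univ * b) := fun ζ hζ b => by
    have := hζ.1
    have h1 : ∫ x, (x - b) ∂ζ = ∫ x, x ∂ζ - ζ.real univ * b := by
      rw [integral_sub hζ.2 (integrable_const b), integral_const, smul_eq_mul]
    have h2 : Integrable (fun x => rightDeriv f b * (x - b)) ζ :=
      (hζ.2.sub (integrable_const b)).const_mul _
    simp only [hl]
    rw [integral_add (integrable_const _) h2, integral_const_mul, h1, integral_const, smul_eq_mul]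
  have hlle : ∀ b, ∫ x, l b x ∂η ≤ ∫ x, l b x ∂χ := fun b => by
    rw [hlval η hη, hlval χ hχ, hmass]
    nlinarith [hp0 b]
  have htan : ∀ b x, l b x ≤ f x := fun b x => by
    have := rightDeriv_mul_le_sub hf b x
    simp only [hl]; linarith
  have he0 : ∀ b x, 0 ≤ e b x := fun b x => by
    have := htan b (min x b)
    simp only [hl, he] at this ⊢; linarith
  have hele : ∀ b x, l b x + e b x ≤ f x := fun b x => by
    rcases le_total x b with hx | hx
    · simp only [hl, he, min_eq_left hx]; linarith
    · have := htan b x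
      simp only [hl, he, min_eq_right hx] at this ⊢; linarith
  have hem : ∀ b, Measurable (e b) := fun b => by
    have h1 : Measurable fun x : ℝ => min x b := measurable_id.min measurable_const
    exact ((hanti.measurable.comp h1).sub measurable_const).add
      ((measurable_const.sub h1).const_mul _)
  have heχ : ∀ b, Integrable (e b) χ := fun b => by
    refine (hfχ.sub (hlint χ hχ b)).mono' (hem b).aestronglyMeasurable
      (Eventually.of_forall fun x => ?_)
    rw [Real.norm_eq_abs, abs_of_nonneg (he0 b x)]
    have := hele b x
    simp only [Pi.sub_apply]; linarith
  have helint : ∀ b, ∫⁻ x, ENNReal.ofReal (e b x) ∂η ≤ ∫⁻ x, ENNReal.ofReal (e b x) ∂χ := fun b => by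
    have hw : Antitone fun t => max (rightDeriv f b - rightDeriv f t) 0 := fun _ _ hst =>
      max_le_max (by linarith [hp hst]) le_rfl
    have := lintegral_mul_le_of_potential_le hη hχ h hw (fun t => le_max_right _ _)
    rw [← lintegral_lintegral_Ici hw.measurable.ennreal_ofReal,
      ← lintegral_lintegral_Ici hw.measurable.ennreal_ofReal] at this
    rwa [lintegral_congr fun x => lintegral_Ici_rightDeriv hf b x,
      lintegral_congr fun x => lintegral_Ici_rightDeriv hf b x] at this
  have heη : ∀ b, Integrable (e b) η := fun b => by
    refine ⟨(hem b).aestronglyMeasurable, ?_⟩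
    rw [hasFiniteIntegral_iff_ofReal (Eventually.of_forall (he0 b))]
    refine (helint b).trans_lt ?_
    rw [← hasFiniteIntegral_iff_ofReal (Eventually.of_forall (he0 b))]
    exact (heχ b).2
  have heile : ∀ b, ∫ x, e b x ∂η ≤ ∫ x, e b x ∂χ := fun b => by
    rw [← ENNReal.ofReal_le_ofReal_iff (integral_nonneg (he0 b)),
      ofReal_integral_eq_lintegral_ofReal (heη b) (Eventually.of_forall (he0 b)),
      ofReal_integral_eq_lintegral_ofReal (heχ b) (Eventually.of_forall (he0 b))]
    exact helint b
  have hbound : ∀ b, ∫ x, (l b x + e b x) ∂η ≤ ∫ x, f x ∂χ := fun b => by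
    have h1 : ∫ x, (l b x + e b x) ∂χ ≤ ∫ x, f x ∂χ :=
      integral_mono ((hlint χ hχ b).add (heχ b)) hfχ (hele b)
    rw [integral_add (hlint _ hη b) (heη b)]
    rw [integral_add (hlint _ hχ b) (heχ b)] at h1
    linarith [hlle b, heile b]
  have hlow : ∀ b, 0 ≤ b → ∀ x, 0 ≤ l b x + e b x - l 0 x := fun b hb x => by
    rcases le_total x b with hx | hx
    · have := htan 0 x
      simp only [hl, he, min_eq_left hx] at this ⊢; linarith
    · have h1 := htan 0 b
      have h2 := hp hb
      simp only [hl, he, min_eq_right hx] at h1 ⊢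
      nlinarith
  have hint : ∀ b, Integrable (fun x => l b x + e b x - l 0 x) η := fun b =>
    ((hlint η hη b).add (heη b)).sub (hlint η hη 0)
  have hsub : ∀ b, ∫ x, (l b x + e b x - l 0 x) ∂η
      = ∫ x, (l b x + e b x) ∂η - ∫ x, l 0 x ∂η := fun b =>
    integral_sub (f := fun x => l b x + e b x) ((hlint η hη b).add (heη b)) (hlint η hη 0)
  set C := ∫ x, f x ∂χ - ∫ x, l 0 x ∂η with hC
  have hle : ∀ b, 0 ≤ b → ∫⁻ x, ENNReal.ofReal (l b x + e b x - l 0 x) ∂η ≤ ENNReal.ofReal C :=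
    fun b hb => by
      rw [← ofReal_integral_eq_lintegral_ofReal (hint b) (Eventually.of_forall (hlow b hb))]
      refine ENNReal.ofReal_le_ofReal ?_
      rw [hsub]
      linarith [hbound b]
  have hC0 : 0 ≤ C := by
    have h1 : 0 ≤ ∫ x, (l 0 x + e 0 x - l 0 x) ∂η := integral_nonneg (hlow 0 le_rfl)
    rw [hsub] at h1
    linarith [hbound 0]
  have hfat : ∫⁻ x, ENNReal.ofReal (f x - l 0 x) ∂η ≤ ENNReal.ofReal C := by
    have h1 : ∀ x, ENNReal.ofReal (f x - l 0 x)
        ≤ liminf (fun n : ℕ => ENNReal.ofReal (l n x + e n x - l 0 x)) atTop := fun x => by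
      have h2 : Tendsto (fun n : ℕ => ENNReal.ofReal (l n x + e n x - l 0 x)) atTop
          (𝓝 (ENNReal.ofReal (f x - l 0 x))) := by
        refine tendsto_const_nhds.congr' ?_
        filter_upwards [eventually_ge_atTop ⌈x⌉₊] with n hn
        have hxn : x ≤ n := (Nat.le_ceil x).trans (by exact_mod_cast hn)
        have : l n x + e n x = f x := by
          simp only [hl, he, min_eq_left hxn]; ring
        rw [this]
      exact h2.liminf_eq.ge
    refine (lintegral_mono h1).trans ((lintegral_liminf_le' fun n => ?_).trans ?_)
    · exact (hint n).aestronglyMeasurable.aemeasurable.ennreal_ofReal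
    · exact liminf_le_of_le (by isBoundedDefault) fun b hb => by
        obtain ⟨n, hn⟩ := hb.exists
        exact hn.trans (hle n (Nat.cast_nonneg n))
  have hnn : ∀ x, 0 ≤ f x - l 0 x := fun x => sub_nonneg.2 (htan 0 x)
  have hi : Integrable (fun x => f x - l 0 x) η := by
    refine ⟨hanti.measurable.aestronglyMeasurable.sub (hlint η hη 0).aestronglyMeasurable, ?_⟩
    rw [hasFiniteIntegral_iff_ofReal (Eventually.of_forall hnn)]
    exact hfat.trans_lt ENNReal.ofReal_lt_top
  have hfη : Integrable f η := by
    have := hi.add (hlint η hη 0)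
    refine this.congr (Eventually.of_forall fun x => ?_)
    simp
  refine ⟨hfη, ?_⟩
  rw [← ofReal_integral_eq_lintegral_ofReal hi (Eventually.of_forall hnn),
    ENNReal.ofReal_le_ofReal_iff hC0, integral_sub hfη (hlint η hη 0)] at hfat
  linarith

end Order

/-! ### Existence and uniqueness of the shadow -/

/-- A splitting of the potential of `ν` into two convex functions comes from a splitting of `ν`. The
two right derivatives are non-decreasing and add up to the distribution function of `ν`, so both
are right-continuous, and their Stieltjes measures add up to `ν`. -/
theorem exists_add_eq_of_convexOn {ν : Measure ℝ} (hν : FiniteFirstMoment ν) {D : ℝ → ℝ}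
    (hD : ConvexOn ℝ univ D) (hD0 : ∀ k, 0 ≤ D k) (hDle : ∀ k, D k ≤ potential ν k)
    (hDsub : ConvexOn ℝ univ (fun k => potential ν k - D k)) :
    ∃ ρ σ : Measure ℝ, FiniteFirstMoment ρ ∧ FiniteFirstMoment σ ∧ ν = ρ + σ ∧
      potential ρ = D := by
  have := hν.1
  set p := rightDeriv D with hpdef
  have hp : Monotone p := monotone_rightDeriv hD
  have hq : Monotone (fun t => distribution ν t - p t) := by
    have h1 := monotone_rightDeriv hDsub
    have h2 : ∀ t, rightDeriv (fun k => potential ν k - D k) t = distribution ν t - p t := fun t =>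
      ((hasDerivWithinAt_potential hν t).sub (hasDerivWithinAt_rightDeriv hD t)).derivWithin
        (uniqueDiffWithinAt_Ioi t)
    intro s t hst
    have h3 := h1 hst
    rwa [h2, h2] at h3
  have hpr : ∀ a, Tendsto p (𝓝[>] a) (𝓝 (p a)) := fun a => by
    have h1 : Tendsto (fun t => p a + (distribution ν t - distribution ν a)) (𝓝[>] a)
        (𝓝 (p a + (distribution ν a - distribution ν a))) :=
      tendsto_const_nhds.add ((distribution_rightContinuous a).sub tendsto_const_nhds)
    rw [sub_self, add_zero] at h1
    refine tendsto_of_tendsto_of_tendsto_of_le_of_le' tendsto_const_nhds h1 ?_ ?_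
    · filter_upwards [self_mem_nhdsWithin] with t ht
      exact hp (le_of_lt ht)
    · filter_upwards [self_mem_nhdsWithin] with t ht
      have := hq (le_of_lt (show a < t from ht))
      simp only at this
      linarith
  have hDlim : Tendsto D atBot (𝓝 0) :=
    tendsto_of_tendsto_of_tendsto_of_le_of_le tendsto_const_nhds (tendsto_potential_atBot hν)
      hD0 hDle
  have hplim : Tendsto p atBot (𝓝 0) := by
    have h1 : Tendsto (fun x => D x - D (x - 1)) atBot (𝓝 (0 - 0)) :=
      hDlim.sub (hDlim.comp (tendsto_atBot_add_const_right _ (-1) tendsto_id))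
    have h2 : Tendsto (fun x => D (x + 1) - D x) atBot (𝓝 (0 - 0)) :=
      (hDlim.comp (tendsto_atBot_add_const_right _ 1 tendsto_id)).sub hDlim
    rw [sub_zero] at h1 h2
    refine tendsto_of_tendsto_of_tendsto_of_le_of_le h1 h2 (fun x => ?_) (fun x => ?_)
    · have := sub_le_rightDeriv_mul hD (show x - 1 ≤ x by linarith)
      simp only [sub_sub_cancel, mul_one] at this
      exact this
    · have := rightDeriv_mul_le hD (show x ≤ x + 1 by linarith)
      simp only [add_sub_cancel_left, mul_one] at this
      exact this
  have hqlim : Tendsto (fun t => distribution ν t - p t) atBot (𝓝 0) := by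
    simpa using (tendsto_distribution_atBot (η := ν)).sub hplim
  have hp0 : ∀ t, 0 ≤ p t := fun t => hp.le_of_tendsto hplim t
  have hq0 : ∀ t, 0 ≤ distribution ν t - p t := fun t => hq.le_of_tendsto hqlim t
  let Sp : StieltjesFunction ℝ := ⟨p, hp, fun a => continuousWithinAt_Ioi_iff_Ici.1 (hpr a)⟩
  let Sq : StieltjesFunction ℝ := ⟨fun t => distribution ν t - p t, hq, fun a =>
    continuousWithinAt_Ioi_iff_Ici.1 ((distribution_rightContinuous a).sub (hpr a))⟩
  have hρIic : ∀ t, Sp.measure (Iic t) = ENNReal.ofReal (p t) := fun t => by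
    rw [Sp.measure_Iic hplim, sub_zero]
  have hσIic : ∀ t, Sq.measure (Iic t) = ENNReal.ofReal (distribution ν t - p t) := fun t => by
    rw [Sq.measure_Iic hqlim, sub_zero]
  have hsum : ν = Sp.measure + Sq.measure := by
    refine Measure.ext_of_Iic _ _ fun t => ?_
    rw [Measure.add_apply, hρIic, hσIic, ← ENNReal.ofReal_add (hp0 t) (hq0 t), add_sub_cancel,
      ofReal_distribution]
  have hρ : FiniteFirstMoment Sp.measure := hν.mono (by
    rw [hsum]; exact Measure.le_add_right le_rfl)
  have hσ : FiniteFirstMoment Sq.measure := hν.mono (by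
    rw [hsum]; exact Measure.le_add_left le_rfl)
  refine ⟨Sp.measure, Sq.measure, hρ, hσ, hsum, ?_⟩
  have hdist : ∀ t, distribution Sp.measure t = p t := fun t => by
    rw [distribution, measureReal_def, hρIic, ENNReal.toReal_ofReal (hp0 t)]
  have hdiff : ∀ a b, potential Sp.measure b - potential Sp.measure a = D b - D a := fun a b => by
    rw [potential_sub_potential hρ, ← integral_rightDeriv hD]
    simp_rw [hdist]
    rfl
  funext b
  have h1 : Tendsto (fun a => potential Sp.measure b - potential Sp.measure a) atBot
      (𝓝 (potential Sp.measure b - 0)) := tendsto_const_nhds.sub (tendsto_potential_atBot hρ)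
  have h2 : Tendsto (fun a => potential Sp.measure b - potential Sp.measure a) atBot
      (𝓝 (D b - 0)) :=
    (tendsto_const_nhds.sub hDlim).congr fun a => (hdiff a b).symm
  simpa using tendsto_nhds_unique h1 h2

/-- The difference of the potentials of `ν` and `μ`. -/
noncomputable def excess (μ ν : Measure ℝ) (k : ℝ) : ℝ := potential ν k - potential μ k

theorem PosConvexDecreasingLE.excess_nonneg {μ ν : Measure ℝ} (hμ : FiniteFirstMoment μ)
    (hν : FiniteFirstMoment ν) (h : PosConvexDecreasingLE μ ν) (k : ℝ) : 0 ≤ excess μ ν k :=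
  sub_nonneg.2 (h.potential_le hμ hν k)

theorem convexOn_zero : ConvexOn ℝ univ (fun _ : ℝ => (0 : ℝ)) := convexOn_const _ convex_univ

/-- The shadow exists, and what it leaves over of `ν` has the greatest convex minorant of the excess as
its potential. That minorant is large enough for the shadow to have the mass of `μ`, because the
excess has an affine minorant of slope `ν(ℝ) - μ(ℝ)`. -/
theorem exists_isShadow {μ ν : Measure ℝ} (hμ : FiniteFirstMoment μ) (hν : FiniteFirstMoment ν)
    (h : PosConvexDecreasingLE μ ν) :
    ∃ σ ρ : Measure ℝ, IsShadow μ ν σ ∧ FiniteFirstMoment ρ ∧ ν = ρ + σ ∧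
      potential ρ = convexMinorant (excess μ ν) := by
  have h0 := h.excess_nonneg hμ hν
  set D := convexMinorant (excess μ ν) with hDdef
  have hD : ConvexOn ℝ univ D := convexOn_convexMinorant convexOn_zero h0
  have hDle : ∀ k, D k ≤ excess μ ν k := convexMinorant_le convexOn_zero h0
  have hDsub : ConvexOn ℝ univ (fun k => potential ν k - D k) :=
    convexOn_sub_convexMinorant (convexOn_potential hν) (convexOn_potential hμ) convexOn_zero h0
  obtain ⟨ρ, σ, hρ, hσ, hsum, hpot⟩ := exists_add_eq_of_convexOn hν hD
    (le_convexMinorant convexOn_zero h0)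
    (fun k => (hDle k).trans (sub_le_self _ (potential_nonneg k))) hDsub
  have := hν.1
  have := hμ.1
  have := hρ.1
  have := hσ.1
  have hσpot : ∀ k, potential σ k = potential ν k - D k := fun k => by
    rw [hsum, potential_add_measure hρ hσ, hpot]; ring
  have hσν : σ ≤ ν := by rw [hsum]; exact Measure.le_add_left le_rfl
  have hμσ : ∀ k, potential μ k ≤ potential σ k := fun k => by
    have := hDle k
    rw [excess] at this
    rw [hσpot]; linarith
  have hmassν : ν.real univ = ρ.real univ + σ.real univ := by
    conv_lhs => rw [hsum]
    exact measureReal_add_apply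
  -- an affine minorant of the excess, of slope `ν(ℝ) - μ(ℝ)`
  have hmassle := h.mass_le hν
  set c := |∫ x, x ∂ν| + ∫ x, |x| ∂μ with hc
  have hc0 : 0 ≤ c := add_nonneg (abs_nonneg _) (integral_nonneg fun x => abs_nonneg x)
  have haff : ∀ k, (ν.real univ - μ.real univ) * k + (-c) ≤ excess μ ν k := fun k => by
    rcases le_total 0 k with hk | hk
    · have h1 := mass_mul_sub_le_potential hν k
      have h2 := potential_le_mass_mul_add hμ hk
      rw [excess]
      linarith [le_abs_self (∫ x, x ∂ν)]
    · have h1 := h0 k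
      nlinarith [mul_nonpos_of_nonneg_of_nonpos (sub_nonneg.2 hmassle) hk]
  have hmass : μ.real univ = σ.real univ := by
    have h1 : ν.real univ - μ.real univ ≤ ρ.real univ :=
      le_mass_of_le_potential hρ (c := c) fun k _ => by
        rw [hpot]
        have := le_convexMinorant (convexOn_affine _ _) haff k
        linarith
    have h2 : μ.real univ ≤ σ.real univ :=
      le_mass_of_le_potential hσ (c := ∫ x, x ∂μ) fun k _ =>
        (mass_mul_sub_le_potential hμ k).trans (hμσ k)
    linarith
  refine ⟨σ, ρ, ⟨⟨hσ, convexDecreasingLE_of_potential_le hμ hσ hmass hμσ, hσν⟩, ?_⟩, hρ, hsum,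
    hpot⟩
  rintro θ ⟨hθ, hμθ, hθν⟩
  have := hθ.1
  refine convexDecreasingLE_of_potential_le hσ hθ (hmass.symm.trans (hμθ.mass_eq hθ)) fun k => ?_
  -- what `θ` leaves over of `ν` has a convex potential below the excess
  have hτ : FiniteFirstMoment (ν - θ) := hν.mono Measure.sub_le
  have hτpot : ∀ k, potential ν k = potential (ν - θ) k + potential θ k := fun k => by
    rw [← potential_add_measure hτ hθ, Measure.sub_add_cancel_of_le hθν]
  have hτle : ∀ k, potential (ν - θ) k ≤ excess μ ν k := fun k => by
    have := hμθ.potential_le hθ k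
    rw [excess, hτpot k]; linarith
  have := le_convexMinorant (convexOn_potential hτ) hτle k
  change _ ≤ D k at this
  rw [hσpot, hτpot]; linarith

theorem IsShadow.unique {μ ν σ τ : Measure ℝ} (hσ : IsShadow μ ν σ) (hτ : IsShadow μ ν τ) :
    σ = τ :=
  eq_of_potential_eq hσ.1.1 hτ.1.1 <| funext fun k => le_antisymm
    ((hσ.2 τ hτ.1).potential_le hτ.1.1 k) ((hτ.2 σ hσ.1).potential_le hσ.1.1 k)

theorem shadow_eq {μ ν σ : Measure ℝ} (hσ : IsShadow μ ν σ) : shadow ν μ = σ := by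
  have h : ∃ σ, IsShadow μ ν σ := ⟨σ, hσ⟩
  rw [shadow, dif_pos h]
  exact h.choose_spec.unique hσ

/-! ### The Wasserstein distance through distribution functions -/

/-- The kernel `1_{0 < t} - 1_{x ≤ t}`. It is `1` between `0` and a positive `x`, it is `-1` between
a negative `x` and `0`, and it vanishes elsewhere, so that it represents the primitive of a function
that vanishes at `0`. -/
noncomputable def primitiveKernel (x t : ℝ) : ℝ :=
  (Ioi (0 : ℝ)).indicator 1 t - (Ici x).indicator 1 t

/-- The integral of `primitiveKernel` in its first variable with respect to `η`: `-F_η` on `(-∞, 0]`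
and `η(ℝ) - F_η` on `(0, ∞)`.. -/
noncomputable def centredTail (η : Measure ℝ) (t : ℝ) : ℝ :=
  (Ioi (0 : ℝ)).indicator (fun _ => η.real univ) t - distribution η t

theorem measurable_primitiveKernel : Measurable (Function.uncurry primitiveKernel) := by
  have h1 : Measurable fun p : ℝ × ℝ => (Ioi (0 : ℝ)).indicator (1 : ℝ → ℝ) p.2 :=
    (measurable_one.indicator measurableSet_Ioi).comp measurable_snd
  have h2 : Measurable ({p : ℝ × ℝ | p.1 ≤ p.2}.indicator (1 : ℝ × ℝ → ℝ)) :=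
    measurable_one.indicator (measurableSet_le measurable_fst measurable_snd)
  exact h1.sub h2

theorem integral_mul_primitiveKernel (s : ℝ → ℝ) (x : ℝ) :
    ∫ t, s t * primitiveKernel x t = ∫ t in (0 : ℝ)..x, s t := by
  rcases le_total 0 x with hx | hx
  · rw [intervalIntegral.integral_of_le hx, ← integral_indicator measurableSet_Ioc]
    refine integral_congr_ae ?_
    filter_upwards [compl_mem_ae_iff.2 (measure_singleton x)] with t ht
    replace ht : t ≠ x := ht
    simp only [primitiveKernel, indicator, mem_Ioi, mem_Ici, mem_Ioc, Pi.one_apply]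
    split_ifs <;> grind
  · rw [intervalIntegral.integral_of_ge hx, ← integral_indicator measurableSet_Ioc, ← integral_neg]
    refine integral_congr_ae ?_
    filter_upwards [compl_mem_ae_iff.2 (measure_singleton x)] with t ht
    replace ht : t ≠ x := ht
    simp only [primitiveKernel, indicator, mem_Ioi, mem_Ici, mem_Ioc, Pi.one_apply]
    split_ifs <;> grind

theorem norm_mul_primitiveKernel_le {s : ℝ → ℝ} (hs : ∀ t, |s t| ≤ 1) (x t : ℝ) :
    ‖s t * primitiveKernel x t‖ ≤ (uIcc 0 x).indicator 1 t := by
  rw [norm_mul, Real.norm_eq_abs, Real.norm_eq_abs]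
  have h1 : |primitiveKernel x t| ≤ (uIcc 0 x).indicator 1 t := by
    simp only [primitiveKernel, indicator, mem_Ioi, mem_Ici, mem_uIcc, Pi.one_apply]
    split_ifs <;> grind
  calc _ ≤ 1 * |primitiveKernel x t| := mul_le_mul_of_nonneg_right (hs t) (abs_nonneg _)
    _ ≤ _ := by rwa [one_mul]

section Wasserstein

variable {η χ : Measure ℝ} {s : ℝ → ℝ}

theorem integrable_mul_primitiveKernel (hη : FiniteFirstMoment η) (hsm : Measurable s)
    (hs : ∀ t, |s t| ≤ 1) :
    Integrable (Function.uncurry fun x t => s t * primitiveKernel x t) (η.prod volume) := by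
  have := hη.1
  have hm : Measurable (Function.uncurry fun x t => s t * primitiveKernel x t) :=
    (hsm.comp measurable_snd).mul measurable_primitiveKernel
  have hind : ∀ x : ℝ, Integrable ((uIcc 0 x).indicator (1 : ℝ → ℝ)) volume := fun x =>
    (integrable_indicator_iff measurableSet_uIcc).2
      (integrableOn_const (by simp [uIcc, Real.volume_Icc]))
  have hrow : ∀ x, Integrable (fun t => s t * primitiveKernel x t) volume := fun x =>
    (hind x).mono' (hm.comp measurable_prodMk_left).aestronglyMeasurable
      (Eventually.of_forall fun t => norm_mul_primitiveKernel_le hs x t)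
  rw [integrable_prod_iff hm.aestronglyMeasurable]
  refine ⟨Eventually.of_forall hrow, hη.2.abs.mono'
    hm.aestronglyMeasurable.norm.integral_prod_right' (Eventually.of_forall fun x => ?_)⟩
  rw [Real.norm_eq_abs, abs_of_nonneg (integral_nonneg fun t => norm_nonneg _)]
  refine (integral_mono (hrow x).norm (hind x)
    fun t => norm_mul_primitiveKernel_le hs x t).trans ?_
  rw [integral_indicator_one measurableSet_uIcc, measureReal_def, uIcc, Real.volume_Icc,
    max_sub_min_eq_abs, ENNReal.toReal_ofReal (abs_nonneg _), sub_zero]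

theorem integral_primitiveKernel_left (hη : FiniteFirstMoment η) (t : ℝ) :
    ∫ x, s t * primitiveKernel x t ∂η = s t * centredTail η t := by
  have := hη.1
  have e : ∀ x, primitiveKernel x t
      = (Ioi (0 : ℝ)).indicator 1 t - (Iic t).indicator (1 : ℝ → ℝ) x := fun x => by
    simp only [primitiveKernel, indicator, mem_Ici, mem_Iic, Pi.one_apply]
  rw [integral_const_mul]
  simp_rw [e]
  have hi : Integrable ((Iic t).indicator (1 : ℝ → ℝ)) η :=
    (integrable_const (1 : ℝ)).indicator measurableSet_Iic
  rw [integral_sub (integrable_const _) hi, integral_const, integral_indicator_one measurableSet_Iic]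
  simp only [centredTail, distribution, indicator, smul_eq_mul, Pi.one_apply, mul_ite, mul_one,
    mul_zero]

theorem integrable_mul_centredTail (hη : FiniteFirstMoment η) (hsm : Measurable s)
    (hs : ∀ t, |s t| ≤ 1) : Integrable (fun t => s t * centredTail η t) volume := by
  have := hη.1
  refine (integrable_mul_primitiveKernel hη hsm hs).integral_prod_right.congr
    (Eventually.of_forall fun t => ?_)
  exact integral_primitiveKernel_left hη t

theorem integrable_primitive (hη : FiniteFirstMoment η) (hsm : Measurable s)
    (hs : ∀ t, |s t| ≤ 1) : Integrable (fun x => ∫ t in (0 : ℝ)..x, s t) η := by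
  have := hη.1
  refine (integrable_mul_primitiveKernel hη hsm hs).integral_prod_left.congr
    (Eventually.of_forall fun x => ?_)
  exact integral_mul_primitiveKernel s x

/-- Integration by parts, as an instance of Fubini's theorem. -/
theorem integral_primitive (hη : FiniteFirstMoment η) (hsm : Measurable s)
    (hs : ∀ t, |s t| ≤ 1) :
    ∫ x, (∫ t in (0 : ℝ)..x, s t) ∂η = ∫ t, s t * centredTail η t := by
  have := hη.1
  have h := integral_integral_swap (integrable_mul_primitiveKernel hη hsm hs)
  simp_rw [integral_mul_primitiveKernel, integral_primitiveKernel_left hη] at h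
  exact h

theorem integrable_centredTail (hη : FiniteFirstMoment η) : Integrable (centredTail η) volume := by
  simpa using integrable_mul_centredTail (s := fun _ => 1) hη measurable_const (by simp)

theorem centredTail_sub (hmass : η.real univ = χ.real univ) (t : ℝ) :
    centredTail η t - centredTail χ t = distribution χ t - distribution η t := by
  simp only [centredTail, hmass]
  ring

theorem integrable_distribution_sub (hη : FiniteFirstMoment η) (hχ : FiniteFirstMoment χ)
    (hmass : η.real univ = χ.real univ) :
    Integrable (fun t => distribution η t - distribution χ t) volume := by
  refine ((integrable_centredTail hχ).sub (integrable_centredTail hη)).congr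
    (Eventually.of_forall fun t => ?_)
  exact centredTail_sub hmass.symm t

theorem integral_primitive_sub (hη : FiniteFirstMoment η) (hχ : FiniteFirstMoment χ)
    (hmass : η.real univ = χ.real univ) (hsm : Measurable s) (hs : ∀ t, |s t| ≤ 1) :
    ∫ x, (∫ t in (0 : ℝ)..x, s t) ∂η - ∫ x, (∫ t in (0 : ℝ)..x, s t) ∂χ
      = ∫ t, s t * (distribution χ t - distribution η t) := by
  rw [integral_primitive hη hsm hs, integral_primitive hχ hsm hs,
    ← integral_sub (integrable_mul_centredTail hη hsm hs) (integrable_mul_centredTail hχ hsm hs)]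
  refine integral_congr_ae (Eventually.of_forall fun t => ?_)
  simp only
  rw [← mul_sub, centredTail_sub hmass]

/-- For measures of equal mass on the line, the Wasserstein distance is the `L¹` distance of the
distribution functions. -/
theorem wasserstein_eq (hη : FiniteFirstMoment η) (hχ : FiniteFirstMoment χ)
    (hmass : η.real univ = χ.real univ) :
    wasserstein η χ = ENNReal.ofReal (∫ t, |distribution η t - distribution χ t|) := by
  have := hη.1
  have := hχ.1
  have hint := integrable_distribution_sub hχ hη hmass.symm
  refine le_antisymm (iSup_le fun ⟨f, hf⟩ => ENNReal.ofReal_le_ofReal ?_) ?_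
  · have hd : ∀ t, |deriv f t| ≤ 1 := fun t => by
      simpa using norm_deriv_le_of_lipschitz (x₀ := t) hf
    have hm : Measurable (deriv f) := measurable_deriv f
    have hf' : ∀ x, f x = f 0 + ∫ t in (0 : ℝ)..x, deriv f t := fun x => by
      rw [(hf.lipschitzOnWith (s := uIcc 0 x)).absolutelyContinuousOnInterval.integral_deriv_eq_sub]
      ring
    have hval : ∀ ζ : Measure ℝ, FiniteFirstMoment ζ →
        ∫ x, f x ∂ζ = ζ.real univ * f 0 + ∫ x, (∫ t in (0 : ℝ)..x, deriv f t) ∂ζ := fun ζ hζ => by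
      have := hζ.1
      rw [integral_congr_ae (Eventually.of_forall hf'),
        integral_add (integrable_const _) (integrable_primitive hζ hm hd), integral_const,
        smul_eq_mul]
    simp only
    rw [hval η hη, hval χ hχ, hmass, add_sub_add_left_eq_sub,
      integral_primitive_sub hη hχ hmass hm hd, ← Real.norm_eq_abs]
    refine (norm_integral_le_integral_norm _).trans ?_
    refine integral_mono_of_nonneg (Eventually.of_forall fun t => norm_nonneg _)
      (integrable_distribution_sub hη hχ hmass).abs (Eventually.of_forall fun t => ?_)
    simp only
    rw [norm_mul, Real.norm_eq_abs, Real.norm_eq_abs, abs_sub_comm (distribution χ t)]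
    exact mul_le_of_le_one_left (abs_nonneg _) (hd t)
  · -- the optimal potential is the primitive of the sign of the difference
    set s : ℝ → ℝ := fun t => if distribution η t ≤ distribution χ t then 1 else -1 with hsdef
    have hsm : Measurable s := Measurable.ite
      (measurableSet_le monotone_distribution.measurable monotone_distribution.measurable)
      measurable_const measurable_const
    have hs : ∀ t, |s t| ≤ 1 := fun t => by
      simp only [hsdef]; split_ifs <;> simp
    have hsi : ∀ a b : ℝ, IntervalIntegrable s volume a b := fun a b =>
      (intervalIntegrable_const (c := (1 : ℝ))).mono_fun hsm.aestronglyMeasurable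
        (Eventually.of_forall fun t => by simpa using hs t)
    have hlip : LipschitzWith 1 (fun x => ∫ t in (0 : ℝ)..x, s t) := by
      refine LipschitzWith.of_dist_le_mul fun x y => ?_
      rw [Real.dist_eq, intervalIntegral.integral_interval_sub_left (hsi _ _) (hsi _ _),
        ← Real.norm_eq_abs, Real.dist_eq]
      exact intervalIntegral.norm_integral_le_of_norm_le_const fun t _ => hs t
    refine le_trans (ENNReal.ofReal_le_ofReal ?_)
      (le_iSup (fun f : {f : ℝ → ℝ // LipschitzWith 1 f} =>
        ENNReal.ofReal |∫ x, f.1 x ∂η - ∫ x, f.1 x ∂χ|) ⟨_, hlip⟩)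
    simp only
    rw [integral_primitive_sub hη hχ hmass hsm hs]
    refine le_trans (le_of_eq (integral_congr_ae (Eventually.of_forall fun t => ?_)))
      (le_abs_self _)
    simp only [hsdef]
    split_ifs with h
    · rw [abs_of_nonpos (by linarith)]; ring
    · rw [abs_of_pos (by linarith [not_le.1 h])]; ring

end Wasserstein

/-! ### Contraction and stability -/

theorem rightDeriv_le_of_monotone_sub {f g : ℝ → ℝ} (hf : ConvexOn ℝ univ f)
    (hg : ConvexOn ℝ univ g) (h : Monotone fun x => g x - f x) (x : ℝ) :
    rightDeriv f x ≤ rightDeriv g x := by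
  have h1 := (hasDerivWithinAt_iff_tendsto_slope' self_notMem_Ioi).1
    (hasDerivWithinAt_rightDeriv hf x)
  have h2 := (hasDerivWithinAt_iff_tendsto_slope' self_notMem_Ioi).1
    (hasDerivWithinAt_rightDeriv hg x)
  refine le_of_tendsto_of_tendsto h1 h2 ?_
  filter_upwards [self_mem_nhdsWithin] with y hy
  replace hy : x < y := hy
  rw [slope_def_field, slope_def_field]
  have h3 := h hy.le
  simp only at h3
  exact div_le_div_of_nonneg_right (by linarith) (by linarith)

/-- One-sided contraction: taking greatest convex minorants does not increase the `L¹` norm of the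
positive part of the difference of the derivatives. With `u` the difference of the derivatives of
`g₁` and `g₂`, the function `g₂ + ∫ u⁺` increases faster than both `g₁` and `g₂`, hence so does its
greatest convex minorant compared with those of `g₁` and `g₂`; and it exceeds `g₂` by at most the
integral of `u⁺`. -/
theorem intervalIntegral_posPart_rightDeriv_sub_le {g₁ g₂ u : ℝ → ℝ} (h₁ : ∀ x, 0 ≤ g₁ x)
    (h₂ : ∀ x, 0 ≤ g₂ x) (hu : Integrable u volume)
    (hg : ∀ x y, (g₁ y - g₂ y) - (g₁ x - g₂ x) = ∫ t in x..y, u t) {x y : ℝ} (hxy : x ≤ y) :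
    ∫ t in x..y, max (rightDeriv (convexMinorant g₁) t - rightDeriv (convexMinorant g₂) t) 0
      ≤ ∫ t, max (u t) 0 := by
  have hup : Integrable (fun t => max (u t) 0) volume := hu.pos_part
  have hup0 : ∀ t, 0 ≤ max (u t) 0 := fun t => le_max_right _ _
  set A := ∫ t, max (u t) 0 with hA
  set a : ℝ → ℝ := fun x => ∫ t in Iic x, max (u t) 0 with ha
  have ha0 : ∀ x, 0 ≤ a x := fun x => integral_nonneg hup0
  have haA : ∀ x, a x ≤ A := fun x =>
    setIntegral_le_integral hup (Eventually.of_forall hup0)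
  have hinc : ∀ x y, a y - a x = ∫ t in x..y, max (u t) 0 := fun x y =>
    intervalIntegral.integral_Iic_sub_Iic hup.integrableOn hup.integrableOn
  set g : ℝ → ℝ := fun x => g₂ x + a x with hgdef
  have hg0 : ∀ x, 0 ≤ g x := fun x => add_nonneg (h₂ x) (ha0 x)
  have hmono₂ : Monotone fun x => g x - g₂ x := fun x y hxy => by
    have h1 := hinc x y
    have h2 := intervalIntegral.integral_nonneg (μ := volume) hxy fun t _ => hup0 t
    simp only [hgdef]; linarith
  have hmono₁ : Monotone fun x => g x - g₁ x := fun x y hxy => by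
    have h1 := hinc x y
    have h2 := hg x y
    have h3 := intervalIntegral.integral_mono_on (μ := volume) hxy hu.intervalIntegrable
      hup.intervalIntegrable fun t _ => le_max_left (u t) 0
    simp only [hgdef]; linarith
  have hD₁ := convexOn_convexMinorant convexOn_zero h₁
  have hD₂ := convexOn_convexMinorant convexOn_zero h₂
  have hD := convexOn_convexMinorant convexOn_zero hg0
  have hp₁ := rightDeriv_le_of_monotone_sub hD₁ hD
    (monotone_convexMinorant_sub convexOn_zero h₁ convexOn_zero hg0 hmono₁)
  have hp₂ := rightDeriv_le_of_monotone_sub hD₂ hD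
    (monotone_convexMinorant_sub convexOn_zero h₂ convexOn_zero hg0 hmono₂)
  have hlow : ∀ z, convexMinorant g₂ z ≤ convexMinorant g z := le_convexMinorant hD₂ fun z =>
    (convexMinorant_le convexOn_zero h₂ z).trans (le_add_of_nonneg_right (ha0 z))
  have hupp : ∀ z, convexMinorant g z + (-A) ≤ convexMinorant g₂ z :=
    le_convexMinorant (hD.add_const (-A)) fun z => by
      have h1 : convexMinorant g z ≤ g₂ z + a z := convexMinorant_le convexOn_zero hg0 z
      linarith [haA z]
  have hi₁ := (monotone_rightDeriv hD₁).intervalIntegrable (μ := volume) (a := x) (b := y)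
  have hi₂ := (monotone_rightDeriv hD₂).intervalIntegrable (μ := volume) (a := x) (b := y)
  have hi := (monotone_rightDeriv hD).intervalIntegrable (μ := volume) (a := x) (b := y)
  have hle : ∫ t in x..y,
      max (rightDeriv (convexMinorant g₁) t - rightDeriv (convexMinorant g₂) t) 0
      ≤ ∫ t in x..y, (rightDeriv (convexMinorant g) t - rightDeriv (convexMinorant g₂) t) := by
    have hmax : IntervalIntegrable (fun t =>
        max (rightDeriv (convexMinorant g₁) t - rightDeriv (convexMinorant g₂) t) 0) volume x y :=
      ⟨(hi₁.sub hi₂).1.pos_part, (hi₁.sub hi₂).2.pos_part⟩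
    refine intervalIntegral.integral_mono_on hxy hmax (hi.sub hi₂) fun t _ => max_le ?_ ?_
    · linarith [hp₁ t]
    · linarith [hp₂ t]
  rw [intervalIntegral.integral_sub hi hi₂, integral_rightDeriv hD, integral_rightDeriv hD₂] at hle
  linarith [hlow x, hupp y]

section Stability

variable {μ μ' ν ν' ρ ρ' : Measure ℝ}

theorem integral_posPart_distribution_sub_le (hμ : FiniteFirstMoment μ)
    (hμ' : FiniteFirstMoment μ') (hν : FiniteFirstMoment ν) (hν' : FiniteFirstMoment ν')
    (hμ_mass : μ.real univ = μ'.real univ) (hν_mass : ν.real univ = ν'.real univ)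
    (h : PosConvexDecreasingLE μ ν) (h' : PosConvexDecreasingLE μ' ν')
    (hρ : FiniteFirstMoment ρ) (hρ' : FiniteFirstMoment ρ')
    (hρ_mass : ρ.real univ = ρ'.real univ)
    (hpot : potential ρ = convexMinorant (excess μ ν))
    (hpot' : potential ρ' = convexMinorant (excess μ' ν')) :
    ∫ t, max (distribution ρ t - distribution ρ' t) 0
      ≤ ∫ t, max ((distribution ν t - distribution ν' t)
        - (distribution μ t - distribution μ' t)) 0 := by
  have := hμ.1
  have := hμ'.1
  have := hν.1
  have := hν'.1
  have hνi := integrable_distribution_sub hν hν' hν_mass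
  have hμi := integrable_distribution_sub hμ hμ' hμ_mass
  have hρi := (integrable_distribution_sub hρ hρ' hρ_mass).pos_part
  have hinc : ∀ x y, (excess μ ν y - excess μ' ν' y) - (excess μ ν x - excess μ' ν' x)
      = ∫ t in x..y, ((distribution ν t - distribution ν' t)
        - (distribution μ t - distribution μ' t)) := fun x y => by
    rw [intervalIntegral.integral_sub hνi.intervalIntegrable hμi.intervalIntegrable,
      intervalIntegral.integral_sub monotone_distribution.intervalIntegrable
        monotone_distribution.intervalIntegrable,
      intervalIntegral.integral_sub monotone_distribution.intervalIntegrable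
        monotone_distribution.intervalIntegrable,
      ← potential_sub_potential hν, ← potential_sub_potential hν', ← potential_sub_potential hμ,
      ← potential_sub_potential hμ']
    simp only [excess]
    ring
  have key := fun n : ℕ => intervalIntegral_posPart_rightDeriv_sub_le (h.excess_nonneg hμ hν)
    (h'.excess_nonneg hμ' hν') (hνi.sub hμi) hinc (x := -(n : ℝ)) (y := n)
    (by linarith [(Nat.cast_nonneg n : (0 : ℝ) ≤ n)])
  simp_rw [← hpot, ← hpot', rightDeriv_potential hρ, rightDeriv_potential hρ'] at key
  exact le_of_tendsto' (intervalIntegral_tendsto_integral hρi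
    (tendsto_neg_atTop_atBot.comp tendsto_natCast_atTop_atTop) tendsto_natCast_atTop_atTop) key

theorem integral_abs_eq {v : ℝ → ℝ} (hv : Integrable v volume) :
    ∫ t, |v t| = (∫ t, max (v t) 0) + ∫ t, max (-v t) 0 := by
  rw [← integral_add hv.pos_part hv.neg_part]
  refine integral_congr_ae (Eventually.of_forall fun t => ?_)
  rcases le_total 0 (v t) with h | h
  · simp [abs_of_nonneg h, h]
  · simp [abs_of_nonpos h, h]

/-- The `L¹` contraction for the parts of `ν` and `ν'` that the shadows leave over, from the one-sided
contraction in both directions. -/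
theorem integral_abs_distribution_sub_le (hμ : FiniteFirstMoment μ)
    (hμ' : FiniteFirstMoment μ') (hν : FiniteFirstMoment ν) (hν' : FiniteFirstMoment ν')
    (hμ_mass : μ.real univ = μ'.real univ) (hν_mass : ν.real univ = ν'.real univ)
    (h : PosConvexDecreasingLE μ ν) (h' : PosConvexDecreasingLE μ' ν')
    (hρ : FiniteFirstMoment ρ) (hρ' : FiniteFirstMoment ρ')
    (hρ_mass : ρ.real univ = ρ'.real univ)
    (hpot : potential ρ = convexMinorant (excess μ ν))
    (hpot' : potential ρ' = convexMinorant (excess μ' ν')) :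
    ∫ t, |distribution ρ t - distribution ρ' t|
      ≤ (∫ t, |distribution ν t - distribution ν' t|)
        + ∫ t, |distribution μ t - distribution μ' t| := by
  have hνi := integrable_distribution_sub hν hν' hν_mass
  have hμi := integrable_distribution_sub hμ hμ' hμ_mass
  have hρi := integrable_distribution_sub hρ hρ' hρ_mass
  have h1 := integral_posPart_distribution_sub_le hμ hμ' hν hν' hμ_mass hν_mass h h' hρ hρ' hρ_mass
    hpot hpot'
  have h2 := integral_posPart_distribution_sub_le hμ' hμ hν' hν hμ_mass.symm hν_mass.symm h' h
    hρ' hρ hρ_mass.symm hpot' hpot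
  have e1 := integral_abs_eq hρi
  have e2 := integral_abs_eq (hνi.sub hμi)
  simp only [Pi.sub_apply, neg_sub] at e1 e2
  have e3 : ∀ t, distribution μ t - distribution μ' t - (distribution ν t - distribution ν' t)
      = distribution ν' t - distribution ν t - (distribution μ' t - distribution μ t) :=
    fun t => by ring
  simp_rw [e3] at e2
  rw [← integral_add hνi.abs hμi.abs]
  calc _ ≤ ∫ t, |distribution ν t - distribution ν' t - (distribution μ t - distribution μ' t)| := by
        rw [e1, e2]; exact add_le_add h1 h2
    _ ≤ _ := integral_mono (hνi.sub hμi).abs (hνi.abs.add hμi.abs) fun t => abs_sub _ _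

end Stability

end SupermartingaleShadow

open SupermartingaleShadow in
theorem theorem3p2 (μ μ' ν ν' : MeasureTheory.Measure ℝ)
    (hμ : FiniteFirstMoment μ) (hμ' : FiniteFirstMoment μ')
    (hν : FiniteFirstMoment ν) (hν' : FiniteFirstMoment ν')
    (hμ_mass : μ Set.univ = μ' Set.univ) (hν_mass : ν Set.univ = ν' Set.univ)
    (h : PosConvexDecreasingLE μ ν) (h' : PosConvexDecreasingLE μ' ν') :
    (∃! σ, IsShadow μ ν σ) ∧ (∃! σ', IsShadow μ' ν' σ') ∧
      wasserstein (shadow ν μ) (shadow ν' μ') ≤ wasserstein μ μ' + 2 * wasserstein ν ν' := by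
  obtain ⟨σ, ρ, hσ, hρ, hsum, hpot⟩ := exists_isShadow hμ hν h
  obtain ⟨σ', ρ', hσ', hρ', hsum', hpot'⟩ := exists_isShadow hμ' hν' h'
  refine ⟨⟨σ, hσ, fun τ hτ => hτ.unique hσ⟩, ⟨σ', hσ', fun τ hτ => hτ.unique hσ'⟩, ?_⟩
  rw [shadow_eq hσ, shadow_eq hσ']
  have hσm := hσ.1.1
  have hσm' := hσ'.1.1
  have := hσm.1
  have := hσm'.1
  have := hρ.1
  have := hρ'.1
  have hμr : μ.real Set.univ = μ'.real Set.univ := by simp only [measureReal_def, hμ_mass]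
  have hνr : ν.real Set.univ = ν'.real Set.univ := by simp only [measureReal_def, hν_mass]
  have hσr : σ.real Set.univ = σ'.real Set.univ := by
    rw [← hσ.1.2.1.mass_eq hσm, ← hσ'.1.2.1.mass_eq hσm', hμr]
  have hρr : ρ.real Set.univ = ρ'.real Set.univ := by
    rw [hsum, hsum', measureReal_add_apply, measureReal_add_apply] at hνr
    linarith
  rw [wasserstein_eq hσm hσm' hσr, wasserstein_eq hμ hμ' hμr, wasserstein_eq hν hν' hνr]
  have hνi := integrable_distribution_sub hν hν' hνr
  have hρi := integrable_distribution_sub hρ hρ' hρr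
  have hσi := integrable_distribution_sub hσm hσm' hσr
  have hle := integral_abs_distribution_sub_le hμ hμ' hν hν' hμr hνr h h' hρ hρ' hρr hpot hpot'
  have hsplit : ∫ t, |distribution σ t - distribution σ' t|
      ≤ (∫ t, |distribution ν t - distribution ν' t|)
        + ∫ t, |distribution ρ t - distribution ρ' t| := by
    rw [← integral_add hνi.abs hρi.abs]
    refine integral_mono hσi.abs (hνi.abs.add hρi.abs) fun t => ?_
    have e1 : distribution ν t = distribution ρ t + distribution σ t := by
      rw [hsum, distribution_add]
    have e2 : distribution ν' t = distribution ρ' t + distribution σ' t := by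
      rw [hsum', distribution_add]
    have e3 : distribution σ t - distribution σ' t
        = (distribution ν t - distribution ν' t) - (distribution ρ t - distribution ρ' t) := by
      rw [e1, e2]; ring
    simp only [e3]
    exact abs_sub _ _
  have hν0 : 0 ≤ ∫ t, |distribution ν t - distribution ν' t| :=
    integral_nonneg fun t => abs_nonneg _
  have hμ0 : 0 ≤ ∫ t, |distribution μ t - distribution μ' t| :=
    integral_nonneg fun t => abs_nonneg _
  rw [show (2 : ENNReal) = ENNReal.ofReal 2 by simp, ← ENNReal.ofReal_mul (by norm_num),
    ← ENNReal.ofReal_add hμ0 (by positivity)]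
  exact ENNReal.ofReal_le_ofReal (by linarith)
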